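/- Let $\mu_0,\mu_1$ be Borel probability measures on $\mathbb{R}^d$ with supports $\mathcal{X}=\mathrm{spt}(\mu_0)$ and $\mathcal{Y}=\mathrm{spt}(\mu_1)$, and let $c(x,y)=|x-y|^2/2$. For $\psi:\mathcal{Y}\to[-\infty,\infty)$ with $\psi\not\equiv-\infty$ let $\psi^c(x)=\inf_{y\in\mathcal{Y}}\{c(x,y)-\psi(y)\}$, $x\in\mathcal{X}$, and define the $c$-transform of functions on $\mathcal{X}$ analogously; a function on $\mathcal{Y}$ is $c$-concave if it is the $c$-transform of a function $\mathcal{X}\to[-\infty,\infty)$ that is not identically $-\infty$. An OT potential from $\mu_1$ to $\mu_0$ is a $c$-concave function $\psi\in L^1(\mu_1)$ on $\mathcal{Y}$ with $\psi^c\in L^1(\mu_0)$ that maximizes $\int\psi^c\,d\mu_0+\int\psi\,d\mu_1$ over $\psi\in L^1(\mu_1)$. For $\varepsilon>0$, the EOT plan $\pi_\varepsilon$ is the minimizer of $\int c\,d\pi+\varepsilon H(\pi\,|\,\mu_0\otimes\mu_1)$ over all couplings $\pi$ of $\mu_0$ and $\mu_1$, where $H$ is the relative entropy, and EOT potentials are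 functions $\varphi_\varepsilon\in L^1(\mu_0)$, $\psi_\varepsilon\in L^1(\mu_1)$, real-valued on $\mathcal{X}$ and $\mathcal{Y}$ respectively, with $d\pi_\varepsilon(x,y)=e^{(\varphi_\varepsilon(x)+\psi_\varepsilon(y)-c(x,y))/\varepsilon}\,d(\mu_0\otimes\mu_1)(x,y)$ and $$\int e^{(\varphi_\varepsilon(x)+\psi_\varepsilon(y)-c(x,y))/\varepsilon}\,d\mu_1(y)=1\quad\text{for all }x\in\mathcal{X},\qquad \int e^{(\varphi_\varepsilon(x)+\psi_\varepsilon(y)-c(x,y))/\varepsilon}\,d\mu_0(x)=1\quad\text{for all }y\in\mathcal{Y}.$$ Suppose that $\mathcal{X}$ and $\mathcal{Y}$ are compact and that one of them is the closure of a connected open subset of $\mathbb{R}^d$. Then there is an OT potential $\psi$ from $\mu_1$ to $\mu_0$ with the normalization $\int\psi^c\,d\mu_0=\int\psi\,d\mu_1$; it is unique everywhere on $\mathcal{Y}$, and $\psi^c$ and $\psi$ are bounded (in particular finite) and Lipschitz on $\mathcal{X}$ and $\mathcal{Y}$, respectively. Furthermore, for every $\varepsilon>0$ there are EOT potentials $(\varphi_\varepsilon,\psi_\varepsilon)$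 with the normalization $\int\varphi_\varepsilon\,d\mu_0=\int\psi_\varepsilon\,d\mu_1$, they are unique everywhere on $\mathcal{X}\times\mathcal{Y}$, and for every sequence $\varepsilon_k>0$ with $\varepsilon_k\to0$ one has $\varphi_{\varepsilon_k}\to\psi^c$ uniformly on $\mathcal{X}$ and $\psi_{\varepsilon_k}\to\psi$ uniformly on $\mathcal{Y}$. -/

import Mathlib

open MeasureTheory Set Filter Topology
open scoped NNReal ENNReal

namespace EOTLemma

noncomputable section

/-- The Euclidean space `ℝᵈ`. -/
abbrev E (d : ℕ) : Type := EuclideanSpace ℝ (Fin d)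

/-- The quadratic cost `c(x, y) = |x - y|² / 2`. -/
def cost {d : ℕ} (x y : E d) : ℝ := ‖x - y‖ ^ 2 / 2

/-- The `c`-transform `x ↦ inf_{y ∈ S} (c(x, y) - ψ(y))` of an extended-real function `ψ` on `S`
(the values of `ψ` outside `S` play no role). The cost being symmetric, the same formula gives the
`c`-transform in both directions. -/
def cTransform {d : ℕ} (S : Set (E d)) (ψ : E d → EReal) (x : E d) : EReal :=
  ⨅ y ∈ S, ((cost x y : ℝ) : EReal) - ψ y

/-- A function `ψ` on `T` is `c`-concave if on `T` it is the `c`-transform of a function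
`φ : S → [-∞, ∞)` that is not identically `-∞`. -/
def IsCConcave {d : ℕ} (S T : Set (E d)) (ψ : E d → EReal) : Prop :=
  ∃ φ : E d → EReal, (∀ x ∈ S, φ x ≠ ⊤) ∧ (∃ x ∈ S, φ x ≠ ⊥) ∧ EqOn ψ (cTransform S φ) T

/-- `f ∈ L¹(μ)` for an extended-real function `f`: it is a.e. finite and its real part is
integrable. -/
def MemL1 {d : ℕ} (f : E d → EReal) (μ : Measure (E d)) : Prop :=
  (∀ᵐ x ∂μ, f x ≠ ⊥ ∧ f x ≠ ⊤) ∧ Integrable (fun x => (f x).toReal) μ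

/-- The integral of an extended-real function; used only for functions with `MemL1 f μ`. -/
def integralE {d : ℕ} (f : E d → EReal) (μ : Measure (E d)) : ℝ :=
  ∫ x, (f x).toReal ∂μ

/-- `ψ` is an optimal transport (Kantorovich) potential from `μ₁` to `μ₀`: a `c`-concave function on
`spt μ₁` with `ψ ∈ L¹(μ₁)`, `ψᶜ ∈ L¹(μ₀)` that maximizes `∫ ψᶜ dμ₀ + ∫ ψ dμ₁` over `L¹(μ₁)`.
(For a competitor `ψ' ∈ L¹(μ₁)` whose transform is not in `L¹(μ₀)` the functional is `-∞`,
so such competitors need not be considered.) -/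
structure IsOTPotential {d : ℕ} (μ₀ μ₁ : Measure (E d)) (ψ : E d → EReal) : Prop where
  cConcave : IsCConcave μ₀.support μ₁.support ψ
  memL1 : MemL1 ψ μ₁
  memL1_cTransform : MemL1 (cTransform μ₁.support ψ) μ₀
  maximal : ∀ ψ' : E d → EReal, MemL1 ψ' μ₁ → MemL1 (cTransform μ₁.support ψ') μ₀ →
    integralE (cTransform μ₁.support ψ') μ₀ + integralE ψ' μ₁ ≤
      integralE (cTransform μ₁.support ψ) μ₀ + integralE ψ μ₁

/-- An optimal transport potential normalized by `∫ ψᶜ dμ₀ = ∫ ψ dμ₁`. -/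
structure IsNormalizedOTPotential {d : ℕ} (μ₀ μ₁ : Measure (E d)) (ψ : E d → EReal) : Prop
    extends IsOTPotential μ₀ μ₁ ψ where
  normalized : integralE (cTransform μ₁.support ψ) μ₀ = integralE ψ μ₁

/-- `π` is a coupling of `μ₀` and `μ₁`. -/
def IsCoupling {d : ℕ} (μ₀ μ₁ : Measure (E d)) (π : Measure (E d × E d)) : Prop :=
  π.map Prod.fst = μ₀ ∧ π.map Prod.snd = μ₁

/-- The entropic objective `∫ c dπ + ε H(π | μ₀ ⊗ μ₁)`, with values in `[0, ∞]`. -/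
def entropicCost {d : ℕ} (ε : ℝ) (μ₀ μ₁ : Measure (E d)) (π : Measure (E d × E d)) : ℝ≥0∞ :=
  ∫⁻ p, ENNReal.ofReal (cost p.1 p.2) ∂π +
    ENNReal.ofReal ε * InformationTheory.klDiv π (μ₀.prod μ₁)

/-- `π` is an entropic optimal transport plan: it minimizes the entropic objective over all
couplings. -/
def IsEOTPlan {d : ℕ} (ε : ℝ) (μ₀ μ₁ : Measure (E d)) (π : Measure (E d × E d)) : Prop :=
  IsCoupling μ₀ μ₁ π ∧
    ∀ π', IsCoupling μ₀ μ₁ π' → entropicCost ε μ₀ μ₁ π ≤ entropicCost ε μ₀ μ₁ π'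

/-- The density `exp ((φ(x) + ψ(y) - c(x, y)) / ε)`. -/
def gibbs {d : ℕ} (ε : ℝ) (φ ψ : E d → ℝ) (x y : E d) : ℝ :=
  Real.exp ((φ x + ψ y - cost x y) / ε)

/-- `(φ, ψ)` are entropic optimal transport potentials, in the version for which the Schrödinger
system holds everywhere on the supports: `φ ∈ L¹(μ₀)`, `ψ ∈ L¹(μ₁)`, the plan with density
`exp ((φ(x) + ψ(y) - c(x, y)) / ε)` with respect to `μ₀ ⊗ μ₁` is the entropic plan, and both
equations of the Schrödinger system hold. -/
structure IsEOTPotentials {d : ℕ} (ε : ℝ) (μ₀ μ₁ : Measure (E d)) (φ ψ : E d → ℝ) : Prop where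
  integrable_left : Integrable φ μ₀
  integrable_right : Integrable ψ μ₁
  plan : IsEOTPlan ε μ₀ μ₁
    ((μ₀.prod μ₁).withDensity fun p => ENNReal.ofReal (gibbs ε φ ψ p.1 p.2))
  system_left : ∀ x ∈ μ₀.support, ∫ y, gibbs ε φ ψ x y ∂μ₁ = 1
  system_right : ∀ y ∈ μ₁.support, ∫ x, gibbs ε φ ψ x y ∂μ₀ = 1

/-- Entropic potentials normalized by `∫ φ dμ₀ = ∫ ψ dμ₁`. -/
structure IsNormalizedEOTPotentials {d : ℕ} (ε : ℝ) (μ₀ μ₁ : Measure (E d)) (φ ψ : E d → ℝ) : Prop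
    extends IsEOTPotentials ε μ₀ μ₁ φ ψ where
  normalized : ∫ x, φ x ∂μ₀ = ∫ y, ψ y ∂μ₁

/-- An extended-real function is bounded (in particular finite) and Lipschitz on `S`. -/
def BoundedLipschitzOn {d : ℕ} (f : E d → EReal) (S : Set (E d)) : Prop :=
  (∃ M : ℝ, ∀ x ∈ S, ((-M : ℝ) : EReal) ≤ f x ∧ f x ≤ (M : EReal)) ∧
    ∃ K : ℝ≥0, LipschitzOnWith K (fun x => (f x).toReal) S

/-- `S` is the closure of a connected open set. -/
def IsClosureOfConnectedOpen {d : ℕ} (S : Set (E d)) : Prop :=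
  ∃ U : Set (E d), IsOpen U ∧ IsConnected U ∧ S = closure U

end

end EOTLemma

/-! Everything reduces to compact metric spaces carrying fully supported probability measures and a
nonnegative Lipschitz cost, namely the two supports with their restricted measures. Full support
turns almost-everywhere equality of continuous functions into equality everywhere.

Each equation of the Schrödinger system says that one potential is the soft (log-exponential)
transform of the other, so every solution inherits the Lipschitz constant of the cost, whatever `ε`
is. A solution comes from maximizing the semi-dual functional over a compact set of Lipschitz
functions (`exists_schrodingerSystem`). The inequality `1 + t ≤ exp t`, with its equality case,
yields uniqueness up to a constant, the comparison of a solution with any pair satisfying `φ' + ψ' ≤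
c`, and bounds uniform in `ε`.

By Arzelà–Ascoli, normalized solutions along `ε → 0` have uniformly convergent subsequences. A limit
is feasible, since otherwise the Gibbs mass near a violating point would blow up
(`feasible_of_tendsto`), and it is dual optimal, since each entropic pair already dominates all
feasible pairs (`optimal_of_tendsto`). This also produces the Kantorovich potential. If the optimal
pair is unique, all subsequences have the same limit and the whole sequence converges.

Uniqueness of the optimal pair is where connectedness enters. The midpoint of two optimal pairs is
optimal, so both pairs are tight at common points `(x, y x)`. For the quadratic cost, tightness
bounds the increment of the difference `u` of the potentials by `⟪x' - x, y x' - y x⟫`. Summing over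
fine subdivisions of a segment makes `u` locally constant (`isRigid_cost`), with no
differentiability argument for the potentials; connectedness and density then make it constant on
the support. -/

namespace EOTLemma

/-! ### Soft transforms and compactness of Lipschitz families. -/

section Abstract

set_option linter.unusedSectionVars false

variable {X Y : Type*}
  [MetricSpace X] [CompactSpace X] [MeasurableSpace X] [BorelSpace X] [SecondCountableTopology X]
  [MetricSpace Y] [CompactSpace Y] [MeasurableSpace Y] [BorelSpace Y] [SecondCountableTopology Y]

/-- One half of the Schrödinger system: each conditional mass of the Gibbs kernel is one. -/
def UnitMass {X Y : Type*} [MeasurableSpace Y] (ε : ℝ) (c : X → Y → ℝ) (ν : Measure Y)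
    (φ : X → ℝ) (ψ : Y → ℝ) : Prop :=
  ∀ x, ∫ y, Real.exp ((φ x + ψ y - c x y) / ε) ∂ν = 1

theorem nonneg_of_integral_exp_eq_one {Z : Type*} [MeasurableSpace Z] {ν : Measure Z}
    {f g : Z → ℝ} {s : ℝ} (hf : ∫ z, Real.exp (f z) ∂ν = 1) (hg : ∫ z, Real.exp (g z) ∂ν = 1)
    (h : ∀ z, f z ≤ g z + s) : 0 ≤ s := by
  have hfi : Integrable (fun z => Real.exp (f z)) ν := by
    by_contra hn
    simp [integral_undef hn] at hf
  have hgi : Integrable (fun z => Real.exp (g z)) ν := by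
    by_contra hn
    simp [integral_undef hn] at hg
  have : ∫ z, Real.exp (f z) ∂ν ≤ ∫ z, Real.exp (g z) * Real.exp s ∂ν := by
    refine integral_mono hfi (hgi.mul_const _) fun z => ?_
    simp only
    rw [← Real.exp_add]
    exact Real.exp_le_exp.2 (h z)
  rw [integral_mul_const, hf, hg, one_mul] at this
  exact Real.one_le_exp_iff.1 this

/-- If `φ' x' - φ x` exceeded `δ + r`, the exponent at `x'` would dominate the one at `x` by a
positive constant, and the two masses could not both equal one. With `ψ = ψ'` this gives the
Lipschitz bound; with `x = x'` it gives stability of the transform in `ψ`. -/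
theorem UnitMass.sub_le {X Y : Type*} [MeasurableSpace Y] {ε : ℝ} (hε : 0 < ε) {c : X → Y → ℝ}
    {ν : Measure Y} {φ φ' : X → ℝ} {ψ ψ' : Y → ℝ}
    (h : UnitMass ε c ν φ ψ) (h' : UnitMass ε c ν φ' ψ') {x x' : X} {δ r : ℝ}
    (hδ : ∀ y, ψ y - ψ' y ≤ δ) (hr : ∀ y, c x' y - c x y ≤ r) :
    φ' x' - φ x ≤ δ + r := by
  have : 0 ≤ (φ x - φ' x' + δ + r) / ε := by
    refine nonneg_of_integral_exp_eq_one (h x) (h' x') fun y => ?_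
    rw [← add_div]
    exact div_le_div_of_nonneg_right (by linarith [hδ y, hr y]) hε.le
  have h2 : 0 ≤ φ x - φ' x' + δ + r := by
    by_contra hn
    exact absurd this (not_le.2 (div_neg_of_neg_of_pos (not_le.1 hn) hε))
  linarith

theorem UnitMass.lipschitzWith {X Y : Type*} [PseudoMetricSpace X] [MeasurableSpace Y] {ε : ℝ}
    (hε : 0 < ε) {c : X → Y → ℝ} {ν : Measure Y} {φ : X → ℝ} {ψ : Y → ℝ} {L : ℝ≥0}
    (hc : ∀ y, LipschitzWith L fun x => c x y)
    (h : UnitMass ε c ν φ ψ) : LipschitzWith L φ := by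
  refine LipschitzWith.of_le_add_mul L fun x x' => ?_
  have := UnitMass.sub_le hε h h (x := x') (x' := x) (δ := 0) (r := L * dist x x')
    (fun y => by simp) (fun y => (le_abs_self _).trans ((hc y).dist_le_mul x x'))
  linarith

theorem exists_unitMass {ε : ℝ} (hε : 0 < ε) {c : X → Y → ℝ} {ν : Measure Y}
    [IsProbabilityMeasure ν] (hc : ∀ x, Continuous (c x)) {ψ : Y → ℝ} (hψ : Continuous ψ) :
    ∃ φ : X → ℝ, UnitMass ε c ν φ ψ := by
  refine ⟨fun x => -ε * Real.log (∫ y, Real.exp ((ψ y - c x y) / ε) ∂ν), fun x => ?_⟩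
  have hcont : Continuous fun y => Real.exp ((ψ y - c x y) / ε) := by
    have := hc x
    fun_prop
  have hpos : 0 < ∫ y, Real.exp ((ψ y - c x y) / ε) ∂ν :=
    integral_exp_pos (hcont.integrable_of_hasCompactSupport (HasCompactSupport.of_compactSpace _))
  have : ∀ y, Real.exp ((-ε * Real.log (∫ y, Real.exp ((ψ y - c x y) / ε) ∂ν) + ψ y - c x y) / ε)
      = (∫ y, Real.exp ((ψ y - c x y) / ε) ∂ν)⁻¹ * Real.exp ((ψ y - c x y) / ε) := by
    intro y
    rw [← Real.exp_log (inv_pos.2 hpos), ← Real.exp_add, Real.log_inv]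
    congr 1
    field_simp
    ring
  simp_rw [this]
  rw [integral_const_mul, inv_mul_cancel₀ hpos.ne']

theorem UnitMass.shift {X Y : Type*} [MeasurableSpace Y] {ε : ℝ} {c : X → Y → ℝ} {ν : Measure Y}
    {φ : X → ℝ} {ψ : Y → ℝ} (h : UnitMass ε c ν φ ψ) (a : ℝ) :
    UnitMass ε c ν (fun x => φ x + a) (fun y => ψ y - a) := by
  intro x
  rw [← h x]
  refine integral_congr_ae (Eventually.of_forall fun y => ?_)
  simp only
  congr 2
  ring

theorem continuous_integrable {ν : Measure Y} [IsFiniteMeasure ν] {f : Y → ℝ}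
    (hf : Continuous f) : Integrable f ν :=
  hf.integrable_of_hasCompactSupport (HasCompactSupport.of_compactSpace _)

theorem continuous_gibbs_uncurry {ε : ℝ} {c : X → Y → ℝ} (hc : Continuous (Function.uncurry c))
    {φ : X → ℝ} {ψ : Y → ℝ} (hφ : Continuous φ) (hψ : Continuous ψ) :
    Continuous fun p : X × Y => Real.exp ((φ p.1 + ψ p.2 - c p.1 p.2) / ε) := by
  have : Continuous fun p : X × Y => c p.1 p.2 := hc
  fun_prop

theorem eq_zero_of_integral_eq_zero {ν : Measure Y} [IsFiniteMeasure ν] [ν.IsOpenPosMeasure]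
    {f : Y → ℝ} (hf : Continuous f) (h0 : ∀ y, 0 ≤ f y) (h : ∫ y, f y ∂ν = 0) (y : Y) :
    f y = 0 := by
  have h1 := (integral_eq_zero_iff_of_nonneg h0 (continuous_integrable hf)).1 h
  exact congrFun ((hf.ae_eq_iff_eq ν continuous_const).1 h1) y

theorem eq_of_integral_le {ν : Measure Y} [IsFiniteMeasure ν] [ν.IsOpenPosMeasure]
    {f g : Y → ℝ} (hf : Continuous f) (hg : Continuous g) (h0 : ∀ y, f y ≤ g y)
    (h : ∫ y, g y ∂ν ≤ ∫ y, f y ∂ν) (y : Y) : f y = g y := by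
  have := eq_zero_of_integral_eq_zero (hg.sub hf) (fun y => sub_nonneg.2 (h0 y)) (ν := ν) (by
    have h1 := integral_mono (continuous_integrable hf) (continuous_integrable hg) h0 (μ := ν)
    have h2 := integral_sub (continuous_integrable hg) (continuous_integrable hf) (μ := ν)
    simp only [Pi.sub_apply] at *
    linarith) y
  simp only [Pi.sub_apply] at this
  linarith

/-- Replacing `φ` by the soft transform of `ψ` increases its integral, strictly unless `φ` was
already the transform. -/
theorem integral_le_of_unitMass {ε : ℝ} (hε : 0 < ε) {c : X → Y → ℝ}
    (hc : Continuous (Function.uncurry c)) {μ : Measure X} {ν : Measure Y}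
    [IsProbabilityMeasure μ] [IsProbabilityMeasure ν]
    {φ φ' : X → ℝ} {ψ : Y → ℝ} (hφ : Continuous φ) (hφ' : Continuous φ') (hψ : Continuous ψ)
    (h : UnitMass ε (fun y x => c x y) μ ψ φ) (h' : UnitMass ε c ν φ' ψ) :
    ∫ x, φ x ∂μ ≤ ∫ x, φ' x ∂μ ∧
      (μ.IsOpenPosMeasure → ∫ x, φ' x ∂μ ≤ ∫ x, φ x ∂μ → ∀ x, φ x = φ' x) := by
  -- Fubini in both orders: by `h` the full kernel has mass one, while by `h'` its inner integral
  -- over `y` is `exp ((φ x - φ' x) / ε)`.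
  have hI : ∫ x, Real.exp ((φ x - φ' x) / ε) ∂μ = 1 := by
    have hint : Integrable (fun p : X × Y => Real.exp ((φ p.1 + ψ p.2 - c p.1 p.2) / ε))
        (μ.prod ν) := continuous_integrable (continuous_gibbs_uncurry hc hφ hψ)
    have h1 := integral_prod _ hint
    have h2 := integral_prod_symm _ hint
    have e2 : ∀ y, ∫ x, Real.exp ((φ x + ψ y - c x y) / ε) ∂μ = 1 := fun y => by
      rw [← h y]; simp_rw [add_comm (ψ y)]
    have e1 : ∀ x, ∫ y, Real.exp ((φ x + ψ y - c x y) / ε) ∂ν = Real.exp ((φ x - φ' x) / ε) := by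
      intro x
      rw [← mul_one (Real.exp ((φ x - φ' x) / ε)), ← h' x, ← integral_const_mul]
      refine integral_congr_ae (Eventually.of_forall fun y => ?_)
      simp only
      rw [← Real.exp_add]
      congr 1
      field_simp
      ring
    simp only [e1] at h1
    simp only [e2] at h2
    rw [← h1, h2]
    simp
  have hc1 : Continuous fun x => Real.exp ((φ x - φ' x) / ε) := by fun_prop
  have hc2 : Continuous fun x => (φ x - φ' x) / ε := by fun_prop
  have hsub : ∫ x, (φ x - φ' x) / ε ∂μ = (∫ x, φ x ∂μ - ∫ x, φ' x ∂μ) / ε := by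
    rw [integral_div, integral_sub (continuous_integrable hφ) (continuous_integrable hφ')]
  -- The nonnegative defect `exp t - 1 - t`, with `t = (φ - φ') / ε`, integrates to the gain divided
  -- by `ε`; it vanishes only at `t = 0`.
  have hkey : ∫ x, (Real.exp ((φ x - φ' x) / ε) - 1 - (φ x - φ' x) / ε) ∂μ =
      -((∫ x, φ x ∂μ - ∫ x, φ' x ∂μ) / ε) := by
    rw [integral_sub (f := fun x => Real.exp ((φ x - φ' x) / ε) - 1)
      ((continuous_integrable hc1).sub (integrable_const _))
      (continuous_integrable hc2), integral_sub (continuous_integrable hc1) (integrable_const _),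
      hI, hsub]
    simp
  have hnn : ∀ x, 0 ≤ Real.exp ((φ x - φ' x) / ε) - 1 - (φ x - φ' x) / ε := fun x => by
    linarith [Real.add_one_le_exp ((φ x - φ' x) / ε)]
  have hle : ∫ x, φ x ∂μ ≤ ∫ x, φ' x ∂μ := by
    have : 0 ≤ ∫ x, (Real.exp ((φ x - φ' x) / ε) - 1 - (φ x - φ' x) / ε) ∂μ := integral_nonneg hnn
    rw [hkey, ← neg_div, le_div_iff₀ hε] at this
    linarith
  refine ⟨hle, fun hpos hge x => ?_⟩
  have h0 := eq_zero_of_integral_eq_zero (ν := μ) ((hc1.sub continuous_const).sub hc2) hnn (by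
    simp only [Pi.sub_apply]
    rw [hkey, le_antisymm hle hge]; simp) x
  simp only [Pi.sub_apply] at h0
  have h3 : (φ x - φ' x) / ε = 0 := by
    by_contra hne
    linarith [Real.add_one_lt_exp hne]
  rcases div_eq_zero_iff.1 h3 with h4 | h4
  · linarith
  · exact absurd h4 hε.ne'

/-- A family of uniformly Lipschitz, uniformly bounded functions is compact (Arzelà–Ascoli). -/
theorem isCompact_lipschitz_bounded (L : ℝ≥0) (M : ℝ) :
    IsCompact {f : C(X, ℝ) | LipschitzWith L f ∧ ∀ x, |f x| ≤ M} := by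
  refine ArzelaAscoli.isCompact_of_equicontinuous _ ?_ ?_
  · have : ContinuousMap.toFun '' {f : C(X, ℝ) | LipschitzWith L f ∧ ∀ x, |f x| ≤ M} =
        {g : X → ℝ | LipschitzWith L g} ∩ Set.pi univ fun _ => Icc (-M) M := by
      ext g
      constructor
      · rintro ⟨f, ⟨h1, h2⟩, rfl⟩
        exact ⟨h1, fun x _ => abs_le.1 (h2 x)⟩
      · rintro ⟨h1, h2⟩
        exact ⟨⟨g, h1.continuous⟩, ⟨h1, fun x => abs_le.2 (h2 x trivial)⟩, rfl⟩
    rw [this]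
    refine (isCompact_univ_pi fun _ => isCompact_Icc).inter_left ?_
    simp only [lipschitzWith_iff_dist_le_mul, ofPred_forall]
    refine isClosed_iInter fun x => isClosed_iInter fun y => isClosed_le ?_ continuous_const
    exact (continuous_apply x).dist (continuous_apply y)
  · exact (LipschitzWith.uniformEquicontinuous _ L fun f => f.2.1).equicontinuous

end Abstract

/-! ### The Schrödinger system: existence, uniqueness and uniform bounds. -/

section Abstract

set_option linter.unusedSectionVars false

variable {X Y : Type*}
  [MetricSpace X] [CompactSpace X] [MeasurableSpace X] [BorelSpace X] [SecondCountableTopology X]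
  [MetricSpace Y] [CompactSpace Y] [MeasurableSpace Y] [BorelSpace Y] [SecondCountableTopology Y]

/-- The Schrödinger system holds everywhere. -/
structure SchrodingerSystem {X Y : Type*} [MeasurableSpace X] [MeasurableSpace Y] (ε : ℝ)
    (c : X → Y → ℝ) (μ : Measure X) (ν : Measure Y) (φ : X → ℝ) (ψ : Y → ℝ) : Prop where
  left : UnitMass ε c ν φ ψ
  right : UnitMass ε (fun y x => c x y) μ ψ φ

/-- The cost is Lipschitz in each variable. -/
structure LipschitzCost {X Y : Type*} [PseudoMetricSpace X] [PseudoMetricSpace Y] (L : ℝ≥0)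
    (c : X → Y → ℝ) : Prop where
  left : ∀ y, LipschitzWith L fun x => c x y
  right : ∀ x, LipschitzWith L (c x)

theorem LipschitzCost.continuous {L : ℝ≥0} {c : X → Y → ℝ} (hc : LipschitzCost L c) :
    Continuous (Function.uncurry c) :=
  (LipschitzWith.uncurry hc.left hc.right).continuous

theorem LipschitzCost.flip {L : ℝ≥0} {c : X → Y → ℝ} (hc : LipschitzCost L c) :
    LipschitzCost L fun y x => c x y :=
  ⟨hc.right, hc.left⟩

theorem lipschitz_abs_le_of_eq_zero {L : ℝ≥0} {f : Y → ℝ} (hf : LipschitzWith L f) {y₀ : Y}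
    (h0 : f y₀ = 0) (y : Y) : |f y| ≤ L * Metric.diam (univ : Set Y) := by
  have h1 := hf.dist_le_mul y y₀
  rw [h0, Real.dist_eq, sub_zero] at h1
  refine h1.trans (mul_le_mul_of_nonneg_left ?_ L.coe_nonneg)
  exact Metric.dist_le_diam_of_mem isCompact_univ.isBounded trivial trivial

/-- A maximizer of `F ψ = ∫ ψ + ∫ T ψ`, with `T` the soft transform, must be a fixed point of the
double soft transform, since applying it strictly increases `F` otherwise. -/
theorem exists_schrodingerSystem {ε : ℝ} (hε : 0 < ε) {L : ℝ≥0} {c : X → Y → ℝ}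
    (hc : LipschitzCost L c) (μ : Measure X) (ν : Measure Y)
    [IsProbabilityMeasure μ] [IsProbabilityMeasure ν] [ν.IsOpenPosMeasure] :
    ∃ (φ : X → ℝ) (ψ : Y → ℝ), SchrodingerSystem ε c μ ν φ ψ := by
  obtain ⟨y₀⟩ : Nonempty Y := nonempty_of_isProbabilityMeasure ν
  choose T hT using fun ψ : C(Y, ℝ) =>
    exists_unitMass hε (ν := ν) (fun x => (hc.right x).continuous) ψ.continuous
  have hTc : ∀ ψ, Continuous (T ψ) := fun ψ => ((hT ψ).lipschitzWith hε hc.left).continuous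
  let F : C(Y, ℝ) → ℝ := fun ψ => ∫ y, ψ y ∂ν + ∫ x, T ψ x ∂μ
  have hF : LipschitzWith 2 F := by
    refine LipschitzWith.of_le_add_mul 2 fun ψ ψ' => ?_
    have hd : ∀ y, |ψ y - ψ' y| ≤ dist ψ ψ' := fun y =>
      ContinuousMap.dist_apply_le_dist (f := ψ) (g := ψ') y
    have h1 : ∫ y, ψ y ∂ν ≤ ∫ y, (ψ' y + dist ψ ψ') ∂ν :=
      integral_mono (continuous_integrable ψ.continuous)
        (continuous_integrable (ψ'.continuous.add continuous_const))
        fun y => by linarith [(abs_le.1 (hd y)).2]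
    have h2 : ∫ x, T ψ x ∂μ ≤ ∫ x, (T ψ' x + dist ψ ψ') ∂μ := by
      refine integral_mono (continuous_integrable (hTc ψ))
        (continuous_integrable ((hTc ψ').add continuous_const)) fun x => ?_
      have := UnitMass.sub_le hε (hT ψ') (hT ψ) (x := x) (x' := x) (δ := dist ψ ψ') (r := 0)
        (fun y => by linarith [(abs_le.1 (hd y)).1]) (fun y => by simp)
      linarith
    rw [integral_add (continuous_integrable ψ'.continuous) (integrable_const _)] at h1
    rw [integral_add (continuous_integrable (hTc ψ')) (integrable_const _)] at h2
    simp only [integral_const, probReal_univ, one_smul] at h1 h2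
    simp only [F, NNReal.coe_ofNat]
    linarith
  -- Adding constants to `ψ` does not change `F`, so pinning the value at `y₀` costs nothing and
  -- supplies the bound needed for compactness.
  let K : Set C(Y, ℝ) :=
    {f | LipschitzWith L f ∧ ∀ y, |f y| ≤ L * Metric.diam (univ : Set Y)} ∩ {f | f y₀ = 0}
  have hK : IsCompact K := (isCompact_lipschitz_bounded L _).inter_right
    (isClosed_eq (continuous_eval_const y₀) continuous_const)
  have hKne : K.Nonempty :=
    ⟨0, ⟨(LipschitzWith.const (0 : ℝ)).weaken zero_le, fun y => by
      simp only [ContinuousMap.zero_apply, abs_zero]; positivity⟩, rfl⟩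
  obtain ⟨ψ, -, hmax⟩ := hK.exists_isMaxOn hKne hF.continuous.continuousOn
  obtain ⟨ψ', hψ'⟩ := exists_unitMass hε (ν := μ) (c := fun y x => c x y)
    (fun y => (hc.left y).continuous) (hTc ψ)
  have hψ'L := hψ'.lipschitzWith hε hc.right
  obtain ⟨h1, h1'⟩ := integral_le_of_unitMass hε hc.flip.continuous (μ := ν) (ν := μ)
    ψ.continuous hψ'L.continuous (hTc ψ) (hT ψ) hψ'
  -- The double transform `ψ'` is Lipschitz; subtracting its value at `y₀` brings it back into `K`,
  -- with `T ψ + a` as compensating partner.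
  let a := ψ' y₀
  let ψ₂ : C(Y, ℝ) := ⟨fun y => ψ' y - a, hψ'L.continuous.sub continuous_const⟩
  have hψ₂L : LipschitzWith L ψ₂ := LipschitzWith.of_dist_le_mul fun y y' => by
    have := hψ'L.dist_le_mul y y'
    simpa [ψ₂] using! this
  have hψ₂ : ψ₂ ∈ K := by
    have h0 : ψ₂ y₀ = 0 := sub_self _
    exact ⟨⟨hψ₂L, lipschitz_abs_le_of_eq_zero hψ₂L h0⟩, h0⟩
  have h3 : UnitMass ε (fun y x => c x y) μ ψ₂ fun x => T ψ x + a := by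
    have := hψ'.shift (-a)
    simpa [ψ₂, sub_eq_add_neg] using! this
  have h4 := (integral_le_of_unitMass hε hc.continuous (μ := μ) (ν := ν)
    ((hTc ψ).add continuous_const) (hTc ψ₂) ψ₂.continuous h3 (hT ψ₂)).1
  have h5 : F ψ₂ ≤ F ψ := hmax hψ₂
  have h6 : ∫ y, ψ₂ y ∂ν = ∫ y, ψ' y ∂ν - a := by
    have := integral_sub (continuous_integrable hψ'L.continuous) (integrable_const a) (μ := ν)
    simpa using! this
  simp only [Pi.add_apply] at h4
  rw [integral_add (continuous_integrable (hTc ψ)) (integrable_const _)] at h4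
  simp only [integral_const, probReal_univ, one_smul] at h4
  -- Maximality and `h4` give `∫ ψ' ≤ ∫ ψ`, which is the equality case of `integral_le_of_unitMass`.
  have h7 : ∀ y, ψ y = ψ' y := h1' inferInstance (by simp only [F] at h5; linarith)
  refine ⟨T ψ, ψ, hT ψ, ?_⟩
  rw [show (ψ : Y → ℝ) = ψ' from funext h7]
  exact hψ'

variable {ε : ℝ} {L : ℝ≥0} {c : X → Y → ℝ} {μ : Measure X} {ν : Measure Y}
  [IsProbabilityMeasure μ] [IsProbabilityMeasure ν] {φ φ' : X → ℝ} {ψ ψ' : Y → ℝ}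

/-- This is the marginal property of the Gibbs plan, tested on sums of functions of one variable.
Continuity on a compact product bounds the density, so integrable test functions suffice. -/
theorem SchrodingerSystem.integral_gibbs_mul (hε : 0 < ε) (hc : LipschitzCost L c)
    (h : SchrodingerSystem ε c μ ν φ ψ) {f : X → ℝ} {g : Y → ℝ}
    (hf : Integrable f μ) (hg : Integrable g ν) :
    Integrable (fun p : X × Y =>
      Real.exp ((φ p.1 + ψ p.2 - c p.1 p.2) / ε) * (f p.1 + g p.2)) (μ.prod ν) ∧
    ∫ p : X × Y, Real.exp ((φ p.1 + ψ p.2 - c p.1 p.2) / ε) * (f p.1 + g p.2) ∂(μ.prod ν) =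
      ∫ x, f x ∂μ + ∫ y, g y ∂ν := by
  have hφ := (h.left.lipschitzWith hε hc.left).continuous
  have hψ := (h.right.lipschitzWith hε hc.right).continuous
  have hcont := continuous_gibbs_uncurry (ε := ε) hc.continuous hφ hψ
  obtain ⟨C, hC⟩ := isCompact_univ.exists_bound_of_continuousOn hcont.continuousOn
  have hfi : Integrable (fun p : X × Y => Real.exp ((φ p.1 + ψ p.2 - c p.1 p.2) / ε) * f p.1)
      (μ.prod ν) := (hf.comp_fst ν).bdd_mul hcont.aestronglyMeasurable
        (Eventually.of_forall fun p => hC p trivial)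
  have hgi : Integrable (fun p : X × Y => Real.exp ((φ p.1 + ψ p.2 - c p.1 p.2) / ε) * g p.2)
      (μ.prod ν) := (hg.comp_snd μ).bdd_mul hcont.aestronglyMeasurable
        (Eventually.of_forall fun p => hC p trivial)
  simp_rw [mul_add]
  refine ⟨hfi.add hgi, ?_⟩
  rw [integral_add hfi hgi, integral_prod _ hfi, integral_prod_symm _ hgi]
  congr 1
  · refine integral_congr_ae (Eventually.of_forall fun x => ?_)
    simp only
    rw [integral_mul_const, h.left x, one_mul]
  · refine integral_congr_ae (Eventually.of_forall fun y => ?_)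
    simp only
    have := h.right y
    simp_rw [add_comm (ψ y)] at this
    rw [integral_mul_const, this, one_mul]

theorem SchrodingerSystem.integral_gibbs (hε : 0 < ε) (hc : LipschitzCost L c)
    (h : SchrodingerSystem ε c μ ν φ ψ) :
    Integrable (fun p : X × Y => Real.exp ((φ p.1 + ψ p.2 - c p.1 p.2) / ε)) (μ.prod ν) ∧
    ∫ p : X × Y, Real.exp ((φ p.1 + ψ p.2 - c p.1 p.2) / ε) ∂(μ.prod ν) = 1 := by
  have := h.integral_gibbs_mul hε hc (f := fun _ => 1) (g := fun _ => 0)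
    (integrable_const _) (integrable_const _)
  simpa using this

/-- Entropic potentials dominate every feasible pair in the dual functional. -/
theorem SchrodingerSystem.integral_le (hε : 0 < ε) (hc : LipschitzCost L c)
    (h : SchrodingerSystem ε c μ ν φ ψ) (hφ' : Integrable φ' μ) (hψ' : Integrable ψ' ν)
    (hle : ∀ᵐ p ∂(μ.prod ν), φ' p.1 + ψ' p.2 ≤ c p.1 p.2) :
    ∫ x, φ' x ∂μ + ∫ y, ψ' y ∂ν ≤ ∫ x, φ x ∂μ + ∫ y, ψ y ∂ν := by
  have hφ := continuous_integrable (ν := μ) (h.left.lipschitzWith hε hc.left).continuous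
  have hψ := continuous_integrable (ν := ν) (h.right.lipschitzWith hε hc.right).continuous
  obtain ⟨h1, h2⟩ := h.integral_gibbs_mul hε hc (hφ'.sub hφ) (hψ'.sub hψ)
  obtain ⟨h3, h4⟩ := h.integral_gibbs hε hc
  -- Feasibility means `b ≤ 0`, so convexity gives `exp a * (b - a) ≤ exp b - exp a ≤ 1 - exp a`.
  -- The last expression integrates to zero.
  have h5 := integral_mono_ae h1 (((integrable_const (1 : ℝ)).sub h3).mul_const ε) (by
    filter_upwards [hle] with p hp
    simp only [Pi.sub_apply]
    set a := (φ p.1 + ψ p.2 - c p.1 p.2) / ε with ha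
    set b := (φ' p.1 + ψ' p.2 - c p.1 p.2) / ε with hb
    have hab : φ' p.1 - φ p.1 + (ψ' p.2 - ψ p.2) = (b - a) * ε := by
      rw [ha, hb]; field_simp; ring
    rw [hab, ← mul_assoc]
    refine mul_le_mul_of_nonneg_right ?_ hε.le
    have hb0 : b ≤ 0 := div_nonpos_of_nonpos_of_nonneg (by linarith) hε.le
    have e1 := Real.add_one_le_exp (b - a)
    have e2 : Real.exp (b - a) * Real.exp a = Real.exp b := by rw [← Real.exp_add]; simp
    have e3 := mul_le_mul_of_nonneg_right e1 (Real.exp_pos a).le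
    have e4 : Real.exp b ≤ 1 := Real.exp_le_one_iff.2 hb0
    nlinarith)
  rw [h2, integral_mul_const] at h5
  simp only [Pi.sub_apply] at h5
  rw [integral_sub (integrable_const _) h3, h4, integral_sub hφ' hφ, integral_sub hψ' hψ] at h5
  simp at h5
  linarith

/-- Strict convexity of `exp`: the gap between the two dual values is `ε` times the integral of the
Bregman defect `exp b - exp a - exp a * (b - a)`. Applied in both directions, it forces equal values
and hence equal sums of potentials. -/
theorem SchrodingerSystem.integral_le_and_eq (hε : 0 < ε) (hc : LipschitzCost L c)
    (h : SchrodingerSystem ε c μ ν φ ψ) (h' : SchrodingerSystem ε c μ ν φ' ψ') :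
    ∫ x, φ' x ∂μ + ∫ y, ψ' y ∂ν ≤ ∫ x, φ x ∂μ + ∫ y, ψ y ∂ν ∧
    (μ.IsOpenPosMeasure → ν.IsOpenPosMeasure →
      ∫ x, φ x ∂μ + ∫ y, ψ y ∂ν ≤ ∫ x, φ' x ∂μ + ∫ y, ψ' y ∂ν →
      ∀ x y, φ x + ψ y = φ' x + ψ' y) := by
  have cφ := (h.left.lipschitzWith hε hc.left).continuous
  have cψ := (h.right.lipschitzWith hε hc.right).continuous
  have cφ' := (h'.left.lipschitzWith hε hc.left).continuous
  have cψ' := (h'.right.lipschitzWith hε hc.right).continuous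
  have cg := continuous_gibbs_uncurry (ε := ε) hc.continuous cφ cψ
  have cg' := continuous_gibbs_uncurry (ε := ε) hc.continuous cφ' cψ'
  obtain ⟨h1, h2⟩ := h.integral_gibbs_mul hε hc
    ((continuous_integrable cφ').sub (continuous_integrable cφ))
    ((continuous_integrable cψ').sub (continuous_integrable cψ))
  obtain ⟨h3, h4⟩ := h.integral_gibbs hε hc
  obtain ⟨h5, h6⟩ := h'.integral_gibbs hε hc
  simp only [Pi.sub_apply] at h1 h2
  rw [integral_sub (continuous_integrable cφ') (continuous_integrable cφ),
    integral_sub (continuous_integrable cψ') (continuous_integrable cψ)] at h2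
  set G : X × Y → ℝ := fun p =>
    (Real.exp ((φ' p.1 + ψ' p.2 - c p.1 p.2) / ε) - Real.exp ((φ p.1 + ψ p.2 - c p.1 p.2) / ε))
      - Real.exp ((φ p.1 + ψ p.2 - c p.1 p.2) / ε) * ((φ' p.1 - φ p.1) + (ψ' p.2 - ψ p.2)) / ε
    with hG
  have hGi : ∫ p, G p ∂(μ.prod ν) =
      -((∫ x, φ' x ∂μ - ∫ x, φ x ∂μ + (∫ y, ψ' y ∂ν - ∫ y, ψ y ∂ν)) / ε) := by
    simp only [hG]
    rw [integral_sub (f := fun p : X × Y => Real.exp ((φ' p.1 + ψ' p.2 - c p.1 p.2) / ε) -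
      Real.exp ((φ p.1 + ψ p.2 - c p.1 p.2) / ε)) (h5.sub h3) (h1.div_const ε), integral_sub h5 h3, h4, h6,
      integral_div, h2]
    ring
  have hGform : ∀ p : X × Y, ∃ a b : ℝ, b - a = ((φ' p.1 - φ p.1) + (ψ' p.2 - ψ p.2)) / ε ∧
      G p = Real.exp a * (Real.exp (b - a) - 1 - (b - a)) := by
    intro p
    refine ⟨(φ p.1 + ψ p.2 - c p.1 p.2) / ε, (φ' p.1 + ψ' p.2 - c p.1 p.2) / ε, by ring, ?_⟩
    rw [mul_sub, mul_sub, ← Real.exp_add]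
    simp only [hG]
    rw [add_sub_cancel]
    ring
  have hG0 : ∀ p, 0 ≤ G p := by
    intro p
    obtain ⟨a, b, -, hab⟩ := hGform p
    rw [hab]
    exact mul_nonneg (Real.exp_pos a).le (by linarith [Real.add_one_le_exp (b - a)])
  have hle : ∫ x, φ' x ∂μ + ∫ y, ψ' y ∂ν ≤ ∫ x, φ x ∂μ + ∫ y, ψ y ∂ν := by
    have : 0 ≤ ∫ p, G p ∂(μ.prod ν) := integral_nonneg hG0
    rw [hGi, ← neg_div, le_div_iff₀ hε] at this
    linarith
  refine ⟨hle, fun _ _ hge x y => ?_⟩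
  have hGc : Continuous G := by
    have := cg'.sub cg
    have h8 : Continuous fun p : X × Y =>
      ((φ' p.1 - φ p.1) + (ψ' p.2 - ψ p.2)) := by fun_prop
    exact this.sub ((cg.mul h8).div_const ε)
  have h0 := eq_zero_of_integral_eq_zero hGc hG0 (ν := μ.prod ν) (by
    rw [hGi, show ∫ x, φ' x ∂μ - ∫ x, φ x ∂μ + (∫ y, ψ' y ∂ν - ∫ y, ψ y ∂ν) = 0 by linarith]
    simp) (x, y)
  obtain ⟨a, b, hba, hab⟩ := hGform (x, y)
  rw [hab] at h0
  have h9 : b - a = 0 := by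
    by_contra hne
    exact (mul_pos (Real.exp_pos a) (by linarith [Real.add_one_lt_exp hne])).ne' h0
  rw [h9] at hba
  rcases div_eq_zero_iff.1 hba.symm with h10 | h10
  · simp only at h10
    linarith
  · exact absurd h10 hε.ne'

theorem eq_of_add_eq_add {X Y : Type*} [MeasurableSpace X] [MeasurableSpace Y]
    {μ : Measure X} {ν : Measure Y}
    [IsProbabilityMeasure μ] [IsProbabilityMeasure ν] {φ φ' : X → ℝ} {ψ ψ' : Y → ℝ}
    (hφ' : Integrable φ' μ) (hψ' : Integrable ψ' ν)
    (h : ∀ x y, φ x + ψ y = φ' x + ψ' y) (hn : ∫ x, φ x ∂μ = ∫ y, ψ y ∂ν)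
    (hn' : ∫ x, φ' x ∂μ = ∫ y, ψ' y ∂ν) : φ = φ' ∧ ψ = ψ' := by
  obtain ⟨x₀⟩ : Nonempty X := nonempty_of_isProbabilityMeasure μ
  obtain ⟨y₀⟩ : Nonempty Y := nonempty_of_isProbabilityMeasure ν
  obtain ⟨a, ha⟩ : ∃ a, ∀ x, φ x = φ' x + a := ⟨φ x₀ - φ' x₀, fun x => by
    linarith [h x y₀, h x₀ y₀]⟩
  have hb : ∀ y, ψ y = ψ' y - a := fun y => by linarith [h x₀ y, ha x₀]
  have e1 : ∫ x, φ x ∂μ = ∫ x, φ' x ∂μ + a := by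
    simp_rw [ha]
    rw [integral_add hφ' (integrable_const _)]; simp
  have e2 : ∫ y, ψ y ∂ν = ∫ y, ψ' y ∂ν - a := by
    simp_rw [hb]
    rw [integral_sub hψ' (integrable_const _)]; simp
  have ha0 : a = 0 := by linarith
  exact ⟨funext fun x => by rw [ha, ha0, add_zero], funext fun y => by rw [hb, ha0, sub_zero]⟩

theorem SchrodingerSystem.unique [μ.IsOpenPosMeasure] [ν.IsOpenPosMeasure]
    (hε : 0 < ε) (hc : LipschitzCost L c)
    (h : SchrodingerSystem ε c μ ν φ ψ) (h' : SchrodingerSystem ε c μ ν φ' ψ')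
    (hn : ∫ x, φ x ∂μ = ∫ y, ψ y ∂ν) (hn' : ∫ x, φ' x ∂μ = ∫ y, ψ' y ∂ν) :
    φ = φ' ∧ ψ = ψ' :=
  eq_of_add_eq_add (continuous_integrable (h'.left.lipschitzWith hε hc.left).continuous)
    (continuous_integrable (h'.right.lipschitzWith hε hc.right).continuous)
    ((h.integral_le_and_eq hε hc h').2 inferInstance inferInstance
      (h'.integral_le_and_eq hε hc h).1) hn hn'

theorem lipschitz_abs_sub_integral_le {f : X → ℝ} (hf : LipschitzWith L f) (x : X) :
    |f x - ∫ z, f z ∂μ| ≤ L * Metric.diam (univ : Set X) := by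
  have hD : ∀ z, |f x - f z| ≤ L * Metric.diam (univ : Set X) := fun z => by
    refine (hf.dist_le_mul x z).trans (mul_le_mul_of_nonneg_left ?_ L.coe_nonneg)
    exact Metric.dist_le_diam_of_mem isCompact_univ.isBounded trivial trivial
  have hfi := continuous_integrable (ν := μ) hf.continuous
  have : f x - ∫ z, f z ∂μ = ∫ z, (f x - f z) ∂μ := by
    rw [integral_sub (integrable_const _) hfi]; simp
  rw [this]
  have := norm_integral_le_of_norm_le_const (μ := μ) (f := fun z => f x - f z)
    (Eventually.of_forall hD)
  simpa using this

/-- Normalized entropic potentials are bounded uniformly in the regularization parameter. -/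
theorem SchrodingerSystem.bounded (hε : 0 < ε) (hc : LipschitzCost L c) {C : ℝ}
    (hc0 : ∀ x y, 0 ≤ c x y) (hC : ∀ x y, c x y ≤ C) (h : SchrodingerSystem ε c μ ν φ ψ)
    (hn : ∫ x, φ x ∂μ = ∫ y, ψ y ∂ν) :
    (∀ x, |φ x| ≤ C + L * Metric.diam (univ : Set X)) ∧
      ∀ y, |ψ y| ≤ C + L * Metric.diam (univ : Set Y) := by
  have hφ := h.left.lipschitzWith hε hc.left
  have hψ := h.right.lipschitzWith hε hc.right
  -- The zero pair is feasible because the cost is nonnegative, so the sum of the two means is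
  -- nonnegative. The upper bound `C` then comes from `t + 1 ≤ exp t`; normalization splits the sum
  -- evenly and the Lipschitz bound controls the oscillation.
  have h0 := h.integral_le hε hc (φ' := fun _ => 0) (ψ' := fun _ => 0) (integrable_const _)
    (integrable_const _) (Eventually.of_forall fun p => by simpa using hc0 p.1 p.2)
  simp only [integral_zero, add_zero] at h0
  have h1 : ∫ x, φ x ∂μ + ∫ y, ψ y ∂ν ≤ C := by
    obtain ⟨h3, h4⟩ := h.integral_gibbs hε hc
    have hφi := (continuous_integrable (ν := μ) hφ.continuous).comp_fst ν
    have hψi := (continuous_integrable (ν := ν) hψ.continuous).comp_snd μ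
    have h5 := integral_mono (((hφi.add hψi).sub (integrable_const C)).div_const ε)
      (h3.sub (integrable_const 1)) (fun p => by
        simp only [Pi.sub_apply, Pi.add_apply]
        have e1 := Real.add_one_le_exp ((φ p.1 + ψ p.2 - c p.1 p.2) / ε)
        have e2 : (φ p.1 + ψ p.2 - C) / ε ≤ (φ p.1 + ψ p.2 - c p.1 p.2) / ε :=
          div_le_div_of_nonneg_right (by linarith [hC p.1 p.2]) hε.le
        linarith)
    simp only [Pi.sub_apply, Pi.add_apply] at h5
    rw [integral_div, integral_sub (f := fun p : X × Y => φ p.1 + ψ p.2) (hφi.add hψi)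
      (integrable_const C), integral_add hφi hψi,
      integral_sub h3 (integrable_const 1), h4, integral_fun_fst, integral_fun_snd] at h5
    simp at h5
    rw [div_le_iff₀ hε] at h5
    linarith
  have hC0 : 0 ≤ C := by
    obtain ⟨x₀⟩ : Nonempty X := nonempty_of_isProbabilityMeasure μ
    obtain ⟨y₀⟩ : Nonempty Y := nonempty_of_isProbabilityMeasure ν
    exact (hc0 x₀ y₀).trans (hC x₀ y₀)
  refine ⟨fun x => ?_, fun y => ?_⟩
  · have := abs_le.1 (lipschitz_abs_sub_integral_le (μ := μ) hφ x)
    exact abs_le.2 ⟨by linarith, by linarith⟩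
  · have := abs_le.1 (lipschitz_abs_sub_integral_le (μ := ν) hψ y)
    exact abs_le.2 ⟨by linarith, by linarith⟩

end Abstract

/-! ### Kantorovich duality, uniqueness under rigidity, and the limit of vanishing regularization.
-/

section Abstract

set_option linter.unusedSectionVars false

variable {X Y : Type*}
  [MetricSpace X] [CompactSpace X] [MeasurableSpace X] [BorelSpace X] [SecondCountableTopology X]
  [MetricSpace Y] [CompactSpace Y] [MeasurableSpace Y] [BorelSpace Y] [SecondCountableTopology Y]

/-- A continuous pair that maximizes the Kantorovich dual functional among continuous pairs. -/
structure IsDualOptimal {X Y : Type*} [TopologicalSpace X] [TopologicalSpace Y]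
    [MeasurableSpace X] [MeasurableSpace Y] (c : X → Y → ℝ) (μ : Measure X) (ν : Measure Y)
    (φ : X → ℝ) (ψ : Y → ℝ) : Prop where
  continuous_left : Continuous φ
  continuous_right : Continuous ψ
  feasible : ∀ x y, φ x + ψ y ≤ c x y
  maximal : ∀ φ' ψ', Continuous φ' → Continuous ψ' → (∀ x y, φ' x + ψ' y ≤ c x y) →
    ∫ x, φ' x ∂μ + ∫ y, ψ' y ∂ν ≤ ∫ x, φ x ∂μ + ∫ y, ψ y ∂ν

/-- Two feasible pairs that are tight along a common relation have first components that differ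
by a constant. -/
def IsRigid {X Y : Type*} [TopologicalSpace X] (c : X → Y → ℝ) : Prop :=
  ∀ (φ φ' : X → ℝ) (ψ ψ' : Y → ℝ), Continuous φ → Continuous φ' →
    (∀ x y, φ x + ψ y ≤ c x y) → (∀ x y, φ' x + ψ' y ≤ c x y) →
    (∀ x, ∃ y, φ x + ψ y = c x y ∧ φ' x + ψ' y = c x y) → ∃ a, ∀ x, φ x = φ' x + a

variable {L : ℝ≥0} {c : X → Y → ℝ} {μ : Measure X} {ν : Measure Y}
  [IsProbabilityMeasure μ] [IsProbabilityMeasure ν] {φ φ' : X → ℝ} {ψ ψ' : Y → ℝ}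

theorem exists_conjugate [Nonempty Y] (hc : LipschitzCost L c) (hψ : Continuous ψ) :
    ∃ φ : X → ℝ, LipschitzWith L φ ∧ (∀ x y, φ x + ψ y ≤ c x y) ∧
      ∀ x, ∃ y, φ x + ψ y = c x y := by
  choose y hy using fun x => isCompact_univ.exists_isMinOn univ_nonempty
    (((hc.right x).continuous.sub hψ).continuousOn (s := univ))
  have hle : ∀ x z, c x (y x) - ψ (y x) ≤ c x z - ψ z := fun x z => (hy x).2 (mem_univ z)
  refine ⟨fun x => c x (y x) - ψ (y x), ?_, fun x z => by linarith [hle x z],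
    fun x => ⟨y x, by ring⟩⟩
  refine LipschitzWith.of_le_add_mul L fun x x' => ?_
  have h1 := hle x (y x')
  have h2 := (le_abs_self _).trans ((hc.left (y x')).dist_le_mul x x')
  linarith

theorem IsDualOptimal.swap (h : IsDualOptimal c μ ν φ ψ) :
    IsDualOptimal (fun y x => c x y) ν μ ψ φ :=
  ⟨h.continuous_right, h.continuous_left, fun y x => by rw [add_comm]; exact h.feasible x y,
    fun ψ' φ' h1 h2 h3 => by
      have := h.maximal φ' ψ' h2 h1 fun x y => by rw [add_comm]; exact h3 y x
      linarith⟩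

/-- Replacing `φ` by the conjugate of `ψ` can only raise it and keeps the pair feasible; optimality
and full support force equality, and the conjugate's infimum is attained by compactness. -/
theorem IsDualOptimal.exists_tight [μ.IsOpenPosMeasure] (hc : LipschitzCost L c)
    (h : IsDualOptimal c μ ν φ ψ) (x : X) : ∃ y, φ x + ψ y = c x y := by
  have : Nonempty Y := nonempty_of_isProbabilityMeasure ν
  obtain ⟨φ', h1, h2, h3⟩ := exists_conjugate hc h.continuous_right
  have h4 := h.maximal φ' ψ h1.continuous h.continuous_right h2
  have h5 : ∀ x, φ x ≤ φ' x := fun x => by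
    obtain ⟨y, hy⟩ := h3 x
    linarith [h.feasible x y]
  have h6 := eq_of_integral_le (ν := μ) h.continuous_left h1.continuous h5 (by linarith) x
  rw [h6]
  exact h3 x

/-- The midpoint of two optimal pairs is optimal. Where the midpoint is tight, both feasible pairs
must be tight. -/
theorem IsDualOptimal.exists_common_tight [μ.IsOpenPosMeasure] (hc : LipschitzCost L c)
    (h : IsDualOptimal c μ ν φ ψ) (h' : IsDualOptimal c μ ν φ' ψ') (x : X) :
    ∃ y, φ x + ψ y = c x y ∧ φ' x + ψ' y = c x y := by
  have e1 := continuous_integrable (ν := μ) h.continuous_left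
  have e2 := continuous_integrable (ν := μ) h'.continuous_left
  have e3 := continuous_integrable (ν := ν) h.continuous_right
  have e4 := continuous_integrable (ν := ν) h'.continuous_right
  have hm : IsDualOptimal c μ ν (fun x => (φ x + φ' x) / 2) (fun y => (ψ y + ψ' y) / 2) := by
    refine ⟨(h.continuous_left.add h'.continuous_left).div_const 2,
      (h.continuous_right.add h'.continuous_right).div_const 2,
      fun x y => by linarith [h.feasible x y, h'.feasible x y], fun φ₁ ψ₁ k1 k2 k3 => ?_⟩
    rw [integral_div, integral_div, integral_add e1 e2, integral_add e3 e4]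
    linarith [h.maximal φ₁ ψ₁ k1 k2 k3, h'.maximal φ₁ ψ₁ k1 k2 k3]
  obtain ⟨y, hy⟩ := hm.exists_tight hc x
  exact ⟨y, by linarith [h.feasible x y, h'.feasible x y],
    by linarith [h.feasible x y, h'.feasible x y]⟩

/-- Rigidity fixes the first components up to a constant `a`. Tightness at `y` makes each second
component the conjugate of the first, so they differ by `-a`. -/
theorem IsDualOptimal.add_eq_add_of_isRigid [μ.IsOpenPosMeasure] [ν.IsOpenPosMeasure]
    (hc : LipschitzCost L c) (hr : IsRigid c) (h : IsDualOptimal c μ ν φ ψ)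
    (h' : IsDualOptimal c μ ν φ' ψ') (x : X) (y : Y) : φ x + ψ y = φ' x + ψ' y := by
  obtain ⟨a, ha⟩ := hr φ φ' ψ ψ' h.continuous_left h'.continuous_left h.feasible h'.feasible
    (h.exists_common_tight hc h')
  obtain ⟨x₁, h1⟩ := h.swap.exists_tight hc.flip y
  obtain ⟨x₂, h2⟩ := h'.swap.exists_tight hc.flip y
  linarith [h.feasible x₂ y, h'.feasible x₁ y, ha x, ha x₁, ha x₂]

theorem IsDualOptimal.add_eq_add [μ.IsOpenPosMeasure] [ν.IsOpenPosMeasure]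
    (hc : LipschitzCost L c) (hr : IsRigid c ∨ IsRigid fun y x => c x y)
    (h : IsDualOptimal c μ ν φ ψ) (h' : IsDualOptimal c μ ν φ' ψ') (x : X) (y : Y) :
    φ x + ψ y = φ' x + ψ' y := by
  rcases hr with hr | hr
  · exact h.add_eq_add_of_isRigid hc hr h' x y
  · linarith [h.swap.add_eq_add_of_isRigid hc.flip hr h'.swap y x]

theorem IsDualOptimal.unique [μ.IsOpenPosMeasure] [ν.IsOpenPosMeasure]
    (hc : LipschitzCost L c) (hr : IsRigid c ∨ IsRigid fun y x => c x y)
    (h : IsDualOptimal c μ ν φ ψ) (h' : IsDualOptimal c μ ν φ' ψ')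
    (hn : ∫ x, φ x ∂μ = ∫ y, ψ y ∂ν) (hn' : ∫ x, φ' x ∂μ = ∫ y, ψ' y ∂ν) :
    φ = φ' ∧ ψ = ψ' :=
  eq_of_add_eq_add (continuous_integrable h'.continuous_left)
    (continuous_integrable h'.continuous_right) (h.add_eq_add hc hr h') hn hn'

theorem exists_normalized_schrodingerSystem {ε : ℝ} (hε : 0 < ε) (hc : LipschitzCost L c)
    (μ : Measure X) (ν : Measure Y)
    [IsProbabilityMeasure μ] [IsProbabilityMeasure ν] [ν.IsOpenPosMeasure] :
    ∃ (φ : X → ℝ) (ψ : Y → ℝ), SchrodingerSystem ε c μ ν φ ψ ∧ ∫ x, φ x ∂μ = ∫ y, ψ y ∂ν := by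
  obtain ⟨φ, ψ, h⟩ := exists_schrodingerSystem hε hc μ ν
  have hφ := continuous_integrable (ν := μ) (h.left.lipschitzWith hε hc.left).continuous
  have hψ := continuous_integrable (ν := ν) (h.right.lipschitzWith hε hc.right).continuous
  set a := (∫ y, ψ y ∂ν - ∫ x, φ x ∂μ) / 2 with ha
  refine ⟨fun x => φ x + a, fun y => ψ y - a, ⟨h.left.shift a, ?_⟩, ?_⟩
  · simpa [sub_eq_add_neg] using h.right.shift (-a)
  · rw [integral_add hφ (integrable_const _), integral_sub hψ (integrable_const _)]
    simp only [integral_const, probReal_univ, one_smul]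
    linarith

/-- A uniform limit of entropic potentials is feasible. -/
theorem feasible_of_tendsto [ν.IsOpenPosMeasure] (hc : LipschitzCost L c) {ε : ℕ → ℝ}
    (hε : ∀ k, 0 < ε k) (hε0 : Tendsto ε atTop (𝓝 0)) {φ : ℕ → C(X, ℝ)} {ψ : ℕ → C(Y, ℝ)}
    (h : ∀ k, UnitMass (ε k) c ν (φ k) (ψ k)) {φ₀ : C(X, ℝ)} {ψ₀ : C(Y, ℝ)}
    (hφ : Tendsto φ atTop (𝓝 φ₀)) (hψ : Tendsto ψ atTop (𝓝 ψ₀)) (x : X) (y : Y) :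
    φ₀ x + ψ₀ y ≤ c x y := by
  by_contra! hlt
  -- Of the margin `3 * δ`, the uniform errors of `φ k` and `ψ k` use less than `2 * δ`. The
  -- exponent on `V` thus stays at least `δ / ε k`, and unit mass gives `δ / ε k * ν V ≤ 1`, false
  -- for small `ε k`.
  obtain ⟨δ, hδ, hδ'⟩ : ∃ δ > 0, φ₀ x + ψ₀ y - c x y > 3 * δ :=
    ⟨(φ₀ x + ψ₀ y - c x y) / 4, by linarith, by linarith⟩
  let V : Set Y := {z | 3 * δ < φ₀ x + ψ₀ z - c x z}
  have hcc := (hc.right x).continuous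
  have hV : IsOpen V := isOpen_lt continuous_const (by fun_prop)
  have hm : 0 < ν.real V :=
    ENNReal.toReal_pos (hV.measure_pos ν ⟨y, hδ'⟩).ne' (measure_ne_top _ _)
  have h1 := Metric.tendsto_nhds.1 hφ δ hδ
  have h2 := Metric.tendsto_nhds.1 hψ δ hδ
  have h3 : ∀ᶠ k in atTop, ε k < δ * ν.real V := hε0.eventually_lt_const (by positivity)
  obtain ⟨k, h1, h2, h3⟩ := (h1.and (h2.and h3)).exists
  have hsub : V ⊆ {z | Real.exp (δ / ε k) ≤ Real.exp ((φ k x + ψ k z - c x z) / ε k)} := by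
    intro z (hz : 3 * δ < _)
    refine Real.exp_le_exp.2 (div_le_div_of_nonneg_right ?_ (hε k).le)
    have e1 : |φ k x - φ₀ x| < δ :=
      (ContinuousMap.dist_apply_le_dist (f := φ k) (g := φ₀) x).trans_lt h1
    have e2 : |ψ k z - ψ₀ z| < δ :=
      (ContinuousMap.dist_apply_le_dist (f := ψ k) (g := ψ₀) z).trans_lt h2
    linarith [(abs_lt.1 e1).1, (abs_lt.1 e2).1]
  have hcont : Continuous fun z => Real.exp ((φ k x + ψ k z - c x z) / ε k) := by fun_prop
  have hmk := mul_meas_ge_le_integral_of_nonneg (μ := ν)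
    (f := fun z => Real.exp ((φ k x + ψ k z - c x z) / ε k))
    (Eventually.of_forall fun z => (Real.exp_pos _).le) (continuous_integrable hcont)
    (Real.exp (δ / ε k))
  rw [h k x] at hmk
  have hmono : ν.real V ≤ ν.real
      {z | Real.exp (δ / ε k) ≤ Real.exp ((φ k x + ψ k z - c x z) / ε k)} := measureReal_mono hsub
  have h5 : δ / ε k ≤ Real.exp (δ / ε k) := by linarith [Real.add_one_le_exp (δ / ε k)]
  have h6 : δ / ε k * ν.real V ≤ 1 :=
    (mul_le_mul h5 hmono hm.le (Real.exp_pos _).le).trans hmk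
  rw [div_mul_eq_mul_div, div_le_one (hε k)] at h6
  linarith

theorem tendsto_integral_continuousMap {f : ℕ → C(X, ℝ)} {f₀ : C(X, ℝ)}
    (h : Tendsto f atTop (𝓝 f₀)) :
    Tendsto (fun k => ∫ x, f k x ∂μ) atTop (𝓝 (∫ x, f₀ x ∂μ)) := by
  rw [Metric.tendsto_nhds] at h ⊢
  intro δ hδ
  filter_upwards [h δ hδ] with k hk
  have : ∫ x, f k x ∂μ - ∫ x, f₀ x ∂μ = ∫ x, (f k x - f₀ x) ∂μ :=
    (integral_sub (continuous_integrable (f k).continuous)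
      (continuous_integrable f₀.continuous)).symm
  rw [Real.dist_eq, this]
  refine lt_of_le_of_lt ?_ hk
  have := norm_integral_le_of_norm_le_const (μ := μ) (f := fun x => f k x - f₀ x)
    (C := dist (f k) f₀) (Eventually.of_forall fun x =>
      ContinuousMap.dist_apply_le_dist (f := f k) (g := f₀) x)
  simpa using this

/-- A uniform limit of entropic potentials is dual optimal, even against integrable pairs. -/
theorem optimal_of_tendsto [ν.IsOpenPosMeasure] (hc : LipschitzCost L c) {ε : ℕ → ℝ}
    (hε : ∀ k, 0 < ε k) (hε0 : Tendsto ε atTop (𝓝 0)) {φ : ℕ → C(X, ℝ)} {ψ : ℕ → C(Y, ℝ)}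
    (h : ∀ k, SchrodingerSystem (ε k) c μ ν (φ k) (ψ k)) {φ₀ : C(X, ℝ)} {ψ₀ : C(Y, ℝ)}
    (hφ : Tendsto φ atTop (𝓝 φ₀)) (hψ : Tendsto ψ atTop (𝓝 ψ₀)) :
    IsDualOptimal c μ ν φ₀ ψ₀ ∧
    ∀ (φ' : X → ℝ) (ψ' : Y → ℝ), Integrable φ' μ → Integrable ψ' ν →
      (∀ᵐ p ∂(μ.prod ν), φ' p.1 + ψ' p.2 ≤ c p.1 p.2) →
      ∫ x, φ' x ∂μ + ∫ y, ψ' y ∂ν ≤ ∫ x, φ₀ x ∂μ + ∫ y, ψ₀ y ∂ν := by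
  have key : ∀ (φ' : X → ℝ) (ψ' : Y → ℝ), Integrable φ' μ → Integrable ψ' ν →
      (∀ᵐ p ∂(μ.prod ν), φ' p.1 + ψ' p.2 ≤ c p.1 p.2) →
      ∫ x, φ' x ∂μ + ∫ y, ψ' y ∂ν ≤ ∫ x, φ₀ x ∂μ + ∫ y, ψ₀ y ∂ν := fun φ' ψ' h1 h2 h3 =>
    ge_of_tendsto' ((tendsto_integral_continuousMap hφ).add (tendsto_integral_continuousMap hψ))
      fun k => (h k).integral_le (hε k) hc h1 h2 h3
  refine ⟨⟨φ₀.continuous, ψ₀.continuous,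
    feasible_of_tendsto hc hε hε0 (fun k => (h k).left) hφ hψ, fun φ' ψ' h1 h2 h3 => ?_⟩, key⟩
  exact key φ' ψ' (continuous_integrable h1) (continuous_integrable h2)
    (Eventually.of_forall fun p => h3 p.1 p.2)

/-- Normalized entropic potentials have uniformly convergent subsequences. -/
theorem exists_subseq_tendsto (hc : LipschitzCost L c) {C : ℝ}
    (hc0 : ∀ x y, 0 ≤ c x y) (hC : ∀ x y, c x y ≤ C) {ε : ℕ → ℝ} (hε : ∀ k, 0 < ε k)
    {φ : ℕ → C(X, ℝ)} {ψ : ℕ → C(Y, ℝ)} (h : ∀ k, SchrodingerSystem (ε k) c μ ν (φ k) (ψ k))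
    (hn : ∀ k, ∫ x, φ k x ∂μ = ∫ y, ψ k y ∂ν) :
    ∃ (g : ℕ → ℕ) (φ₀ : C(X, ℝ)) (ψ₀ : C(Y, ℝ)), StrictMono g ∧ LipschitzWith L φ₀ ∧
      LipschitzWith L ψ₀ ∧ ∫ x, φ₀ x ∂μ = ∫ y, ψ₀ y ∂ν ∧
      Tendsto (fun k => φ (g k)) atTop (𝓝 φ₀) ∧ Tendsto (fun k => ψ (g k)) atTop (𝓝 ψ₀) := by
  have hK := (isCompact_lipschitz_bounded (X := X) L
    (C + L * Metric.diam (univ : Set X))).prod (isCompact_lipschitz_bounded (X := Y) L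
    (C + L * Metric.diam (univ : Set Y)))
  obtain ⟨⟨φ₀, ψ₀⟩, hmem, g, hg, hlim⟩ := hK.tendsto_subseq (x := fun k => (φ k, ψ k)) fun k =>
    ⟨⟨(h k).left.lipschitzWith (hε k) hc.left, ((h k).bounded (hε k) hc hc0 hC (hn k)).1⟩,
      ⟨(h k).right.lipschitzWith (hε k) hc.right, ((h k).bounded (hε k) hc hc0 hC (hn k)).2⟩⟩
  have h1 : Tendsto (fun k => φ (g k)) atTop (𝓝 φ₀) := (Prod.tendsto_iff _ _).1 hlim |>.1
  have h2 : Tendsto (fun k => ψ (g k)) atTop (𝓝 ψ₀) := (Prod.tendsto_iff _ _).1 hlim |>.2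
  refine ⟨g, φ₀, ψ₀, hg, hmem.1.1, hmem.2.1, ?_, h1, h2⟩
  refine tendsto_nhds_unique (tendsto_integral_continuousMap h1) ?_
  simp_rw [hn]
  exact tendsto_integral_continuousMap h2

/-- The optimal pair is obtained as a limit of entropic pairs, here with `ε = 1 / (k + 1)`; no
rigidity is needed for existence. -/
theorem exists_dualOptimal [ν.IsOpenPosMeasure] (hc : LipschitzCost L c) {C : ℝ}
    (hc0 : ∀ x y, 0 ≤ c x y) (hC : ∀ x y, c x y ≤ C) (μ : Measure X) [IsProbabilityMeasure μ] :
    ∃ (φ : X → ℝ) (ψ : Y → ℝ), LipschitzWith L φ ∧ LipschitzWith L ψ ∧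
      ∫ x, φ x ∂μ = ∫ y, ψ y ∂ν ∧ IsDualOptimal c μ ν φ ψ ∧
      ∀ (φ' : X → ℝ) (ψ' : Y → ℝ), Integrable φ' μ → Integrable ψ' ν →
        (∀ᵐ p ∂(μ.prod ν), φ' p.1 + ψ' p.2 ≤ c p.1 p.2) →
        ∫ x, φ' x ∂μ + ∫ y, ψ' y ∂ν ≤ ∫ x, φ x ∂μ + ∫ y, ψ y ∂ν := by
  have hε : ∀ k : ℕ, 0 < 1 / ((k : ℝ) + 1) := fun k => Nat.one_div_pos_of_nat
  choose φ ψ h hn using fun k : ℕ => exists_normalized_schrodingerSystem (hε k) hc μ ν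
  obtain ⟨g, φ₀, ψ₀, hg, hφL, hψL, hn0, h1, h2⟩ := exists_subseq_tendsto hc hc0 hC hε
    (φ := fun k => ⟨φ k, ((h k).left.lipschitzWith (hε k) hc.left).continuous⟩)
    (ψ := fun k => ⟨ψ k, ((h k).right.lipschitzWith (hε k) hc.right).continuous⟩) h hn
  obtain ⟨h3, h4⟩ := optimal_of_tendsto hc (fun k => hε (g k))
    (tendsto_one_div_add_atTop_nhds_zero_nat.comp hg.tendsto_atTop) (fun k => h (g k)) h1 h2
  exact ⟨φ₀, ψ₀, hφL, hψL, hn0, h3, h4⟩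

theorem tendstoUniformly_of_isRigid [μ.IsOpenPosMeasure] [ν.IsOpenPosMeasure]
    (hc : LipschitzCost L c) {C : ℝ} (hc0 : ∀ x y, 0 ≤ c x y) (hC : ∀ x y, c x y ≤ C)
    (hr : IsRigid c ∨ IsRigid fun y x => c x y) {φ₀ : X → ℝ} {ψ₀ : Y → ℝ}
    (hopt : IsDualOptimal c μ ν φ₀ ψ₀) (hn0 : ∫ x, φ₀ x ∂μ = ∫ y, ψ₀ y ∂ν)
    {ε : ℕ → ℝ} (hε : ∀ k, 0 < ε k) (hε0 : Tendsto ε atTop (𝓝 0))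
    {φ : ℕ → X → ℝ} {ψ : ℕ → Y → ℝ} (h : ∀ k, SchrodingerSystem (ε k) c μ ν (φ k) (ψ k))
    (hn : ∀ k, ∫ x, φ k x ∂μ = ∫ y, ψ k y ∂ν) :
    TendstoUniformly φ φ₀ atTop ∧ TendstoUniformly ψ ψ₀ atTop := by
  let Φ : ℕ → C(X, ℝ) := fun k => ⟨φ k, ((h k).left.lipschitzWith (hε k) hc.left).continuous⟩
  let Ψ : ℕ → C(Y, ℝ) := fun k => ⟨ψ k, ((h k).right.lipschitzWith (hε k) hc.right).continuous⟩
  have key : Tendsto (fun k => (Φ k, Ψ k)) atTop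
      (𝓝 ((⟨φ₀, hopt.continuous_left⟩ : C(X, ℝ)), (⟨ψ₀, hopt.continuous_right⟩ : C(Y, ℝ)))) := by
    -- Every subsequence has a further one converging to a normalized optimal pair, and rigidity
    -- leaves only one such pair.
    refine tendsto_of_subseq_tendsto fun ns hns => ?_
    obtain ⟨g, φ₁, ψ₁, hg, -, -, hn1, h1, h2⟩ := exists_subseq_tendsto hc hc0 hC
      (fun k => hε (ns k)) (φ := fun k => Φ (ns k)) (ψ := fun k => Ψ (ns k))
      (fun k => h (ns k)) fun k => hn (ns k)
    have h3 := (optimal_of_tendsto hc (fun k => hε (ns (g k)))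
      (hε0.comp (hns.comp hg.tendsto_atTop)) (fun k => h (ns (g k))) h1 h2).1
    obtain ⟨e1, e2⟩ := hopt.unique hc hr h3 hn0 hn1
    refine ⟨g, ?_⟩
    have e1' : (⟨φ₀, hopt.continuous_left⟩ : C(X, ℝ)) = φ₁ := ContinuousMap.ext (congrFun e1)
    have e2' : (⟨ψ₀, hopt.continuous_right⟩ : C(Y, ℝ)) = ψ₁ := ContinuousMap.ext (congrFun e2)
    rw [e1', e2']
    exact h1.prodMk_nhds h2
  exact ⟨ContinuousMap.tendsto_iff_tendstoUniformly.1 ((Prod.tendsto_iff _ _).1 key).1,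
    ContinuousMap.tendsto_iff_tendstoUniformly.1 ((Prod.tendsto_iff _ _).1 key).2⟩

end Abstract

/-! ### Rigidity of the quadratic cost on the closure of a connected open set. -/

theorem eq_of_abs_sub_le_inner {F : Type*} [NormedAddCommGroup F] [InnerProductSpace ℝ F]
    {B : Set F} (hB : Convex ℝ B) {u : F → ℝ} {w : F → F}
    (h : ∀ x ∈ B, ∀ x' ∈ B, |u x' - u x| ≤ inner ℝ (x' - x) (w x' - w x))
    {x x' : F} (hx : x ∈ B) (hx' : x' ∈ B) : u x' = u x := by
  -- Cut the segment into `n` equal pieces. Each increment of `u` gains a factor `1 / n` from the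
  -- step `x' - x`, while the increments of `w` telescope, so the right side does not depend on `n`.
  have key : ∀ n : ℕ, 0 < n → n * |u x' - u x| ≤ inner ℝ (x' - x) (w x' - w x) := by
    intro n hn
    have hn' : (0 : ℝ) < n := by exact_mod_cast hn
    let p : ℕ → F := fun k => x + ((k : ℝ) / n) • (x' - x)
    have hp0 : p 0 = x := by simp [p]
    have hpn : p n = x' := by simp [p, div_self hn'.ne']
    have hpB : ∀ k ≤ n, p k ∈ B := fun k hk => hB.add_smul_sub_mem hx hx'
      ⟨by positivity, (div_le_one hn').2 (by exact_mod_cast hk)⟩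
    have hstep : ∀ k, p (k + 1) - p k = (1 / (n : ℝ)) • (x' - x) := fun k => by
      simp only [p, add_sub_add_left_eq_sub, ← sub_smul]
      congr 1
      push_cast
      ring
    have h1 : u x' - u x = ∑ k ∈ Finset.range n, (u (p (k + 1)) - u (p k)) := by
      rw [Finset.sum_range_sub (fun k => u (p k)), hp0, hpn]
    have h2 : w x' - w x = ∑ k ∈ Finset.range n, (w (p (k + 1)) - w (p k)) := by
      rw [Finset.sum_range_sub (fun k => w (p k)), hp0, hpn]
    rw [h1, h2, inner_sum]
    have h3 := Finset.abs_sum_le_sum_abs (fun k => u (p (k + 1)) - u (p k)) (Finset.range n)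
    refine (mul_le_mul_of_nonneg_left h3 hn'.le).trans ?_
    rw [Finset.mul_sum]
    refine Finset.sum_le_sum fun k hk => ?_
    have hk' := Finset.mem_range.1 hk
    have h4 := h _ (hpB k hk'.le) _ (hpB (k + 1) hk')
    rw [hstep, real_inner_smul_left] at h4
    calc (n : ℝ) * |u (p (k + 1)) - u (p k)|
        ≤ n * (1 / n * inner ℝ (x' - x) (w (p (k + 1)) - w (p k))) :=
          mul_le_mul_of_nonneg_left h4 hn'.le
      _ = _ := by field_simp
  by_contra hne
  have hpos : 0 < |u x' - u x| := abs_pos.2 (sub_ne_zero.2 hne)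
  obtain ⟨n, hn⟩ := exists_nat_gt (inner ℝ (x' - x) (w x' - w x) / |u x' - u x|)
  rw [div_lt_iff₀ hpos] at hn
  rcases Nat.eq_zero_or_pos n with rfl | hn0
  · have := key 1 one_pos
    simp at this hn
    linarith
  · linarith [key n hn0]

theorem isConst_of_eq_on_balls {F : Type*} [NormedAddCommGroup F] [NormedSpace ℝ F]
    {U : Set F} (hU : IsOpen U) (hU' : IsPreconnected U) {u : F → ℝ}
    (h : ∀ x ∈ U, ∀ᶠ x' in 𝓝 x, u x' = u x) : ∃ a, ∀ x ∈ U, u x = a := by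
  have hd : ∀ x ∈ U, HasFDerivAt u (0 : F →L[ℝ] ℝ) x := fun x hx =>
    (hasFDerivAt_const (u x) x).congr_of_eventuallyEq (h x hx)
  exact hU.exists_is_const_of_fderiv_eq_zero hU'
    (fun x hx => (hd x hx).differentiableAt.differentiableWithinAt)
    fun x hx => (hd x hx).fderiv

theorem cost_sub_add_cost_sub {d : ℕ} (x x' y y' : E d) :
    cost x' y - cost x y + (cost x y' - cost x' y') = inner ℝ (x' - x) (y' - y) := by
  simp only [cost, norm_sub_sq_real, inner_sub_left, inner_sub_right]
  ring

theorem cost_comm {d : ℕ} (x y : E d) : cost x y = cost y x := by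
  simp only [cost, norm_sub_rev]

theorem cost_nonneg {d : ℕ} (x y : E d) : 0 ≤ cost x y := by
  unfold cost; positivity

/-- With tight points `y x` and `y x'`, feasibility traps both `φ x' - φ x` and `φ' x' - φ' x`
between `c x' (y x') - c x (y x')` and `c x' (y x) - c x (y x)`. The width of that interval is `⟪x'
- x, y x' - y x⟫`, which bounds the increment of `φ - φ'`. -/
theorem isRigid_cost {d : ℕ} {S : Set (E d)} (hS : IsClosureOfConnectedOpen S) (T : Set (E d)) :
    IsRigid fun (x : S) (y : T) => cost (x : E d) y := by
  classical
  obtain ⟨U, hU, hUc, rfl⟩ := hS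
  intro φ φ' ψ ψ' hφ hφ' hle hle' htight
  choose y hy hy' using htight
  let u : E d → ℝ := fun x => if h : x ∈ closure U then φ ⟨x, h⟩ - φ' ⟨x, h⟩ else 0
  let w : E d → E d := fun x => if h : x ∈ closure U then (y ⟨x, h⟩ : E d) else 0
  have hu : ∀ x : closure U, u x = φ x - φ' x := fun x => by simp [u]
  have hw : ∀ x : closure U, w x = y x := fun x => by simp [w]
  have hkey : ∀ x ∈ U, ∀ x' ∈ U, |u x' - u x| ≤ inner ℝ (x' - x) (w x' - w x) := by
    intro x hx x' hx'
    lift x to closure U using subset_closure hx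
    lift x' to closure U using subset_closure hx'
    rw [hu, hu, hw, hw, ← cost_sub_add_cost_sub]
    refine abs_le.2 ⟨?_, ?_⟩
    · linarith [hy x, hy' x, hy x', hy' x', hle x' (y x), hle' x' (y x), hle x (y x'),
        hle' x (y x')]
    · linarith [hy x, hy' x, hy x', hy' x', hle x' (y x), hle' x' (y x), hle x (y x'),
        hle' x (y x')]
  obtain ⟨a, ha⟩ := isConst_of_eq_on_balls hU hUc.isPreconnected (u := u) fun x hx => by
    obtain ⟨r, hr, hrU⟩ := Metric.isOpen_iff.1 hU x hx
    filter_upwards [Metric.ball_mem_nhds x hr] with x' hx'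
    exact eq_of_abs_sub_le_inner (convex_ball x r)
      (fun z hz z' hz' => hkey z (hrU hz) z' (hrU hz')) (Metric.mem_ball_self hr) hx'
  -- The constant is known only on `U`; continuity of the potentials carries it to the closure.
  have hdense : Dense (Subtype.val ⁻¹' U : Set (closure U)) := by
    rw [Subtype.dense_iff]
    intro x hx
    rwa [Subtype.image_preimage_coe, inter_eq_right.2 subset_closure]
  refine ⟨a, congrFun (Continuous.ext_on hdense hφ (hφ'.add continuous_const) fun x hx => ?_)⟩
  have := ha x hx
  rw [hu] at this
  linarith

/-! ### The Gibbs density defines the entropic plan. -/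

section Plan

set_option linter.unusedSectionVars false

variable {d : ℕ} {ε : ℝ} {μ₀ μ₁ : Measure (E d)} {φ ψ : E d → ℝ}

theorem IsCoupling.isProbabilityMeasure [IsProbabilityMeasure μ₀] {π : Measure (E d × E d)}
    (h : IsCoupling μ₀ μ₁ π) : IsProbabilityMeasure π := by
  have : IsProbabilityMeasure (π.map Prod.fst) := by rw [h.1]; infer_instance
  exact (Measure.isProbabilityMeasure_map_iff measurable_fst.aemeasurable).1 this

theorem continuous_cost : Continuous fun p : E d × E d => cost p.1 p.2 := by
  unfold cost; fun_prop

theorem exists_cost_le {S T : Set (E d)} (hS : IsCompact S) (hT : IsCompact T) :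
    ∃ C : ℝ, ∀ x ∈ S, ∀ y ∈ T, cost x y ≤ C := by
  obtain ⟨C, hC⟩ := (hS.prod hT).exists_bound_of_continuousOn continuous_cost.continuousOn
  exact ⟨C, fun x hx y hy => (le_abs_self _).trans (hC (x, y) ⟨hx, hy⟩)⟩

theorem IsCoupling.integrable_cost [IsProbabilityMeasure μ₀] (hX : IsCompact μ₀.support)
    (hY : IsCompact μ₁.support) {π : Measure (E d × E d)}
    (h : IsCoupling μ₀ μ₁ π) : Integrable (fun p : E d × E d => cost p.1 p.2) π := by
  have := h.isProbabilityMeasure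
  obtain ⟨C, hC⟩ := exists_cost_le hX hY
  refine Integrable.of_bound continuous_cost.aestronglyMeasurable C ?_
  have h1 : ∀ᵐ p ∂π, p.1 ∈ μ₀.support := by
    have : ∀ᵐ x ∂(π.map Prod.fst), x ∈ μ₀.support := by rw [h.1]; exact Measure.support_mem_ae
    exact ae_of_ae_map measurable_fst.aemeasurable this
  have h2 : ∀ᵐ p ∂π, p.2 ∈ μ₁.support := by
    have : ∀ᵐ x ∂(π.map Prod.snd), x ∈ μ₁.support := by rw [h.2]; exact Measure.support_mem_ae
    exact ae_of_ae_map measurable_snd.aemeasurable this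
  filter_upwards [h1, h2] with p hp1 hp2
  rw [Real.norm_of_nonneg (cost_nonneg _ _)]
  exact hC _ hp1 _ hp2

theorem lintegral_ofReal_eq_one {Z : Type*} [MeasurableSpace Z] {μ : Measure Z} {f : Z → ℝ}
    (h0 : ∀ z, 0 ≤ f z) (h : ∫ z, f z ∂μ = 1) : ∫⁻ z, ENNReal.ofReal (f z) ∂μ = 1 := by
  have hi : Integrable f μ := by
    by_contra hn
    simp [integral_undef hn] at h
  rw [← ofReal_integral_eq_lintegral_ofReal hi (Eventually.of_forall h0), h, ENNReal.ofReal_one]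

variable [IsProbabilityMeasure μ₀] [IsProbabilityMeasure μ₁]

theorem measurable_gibbs (hφ : Measurable φ) (hψ : Measurable ψ) :
    Measurable fun p : E d × E d => gibbs ε φ ψ p.1 p.2 := by
  have := (continuous_cost (d := d)).measurable
  unfold gibbs
  fun_prop

theorem isCoupling_gibbs (hφ : Measurable φ) (hψ : Measurable ψ)
    (hl : ∀ x ∈ μ₀.support, ∫ y, gibbs ε φ ψ x y ∂μ₁ = 1)
    (hr : ∀ y ∈ μ₁.support, ∫ x, gibbs ε φ ψ x y ∂μ₀ = 1) :
    IsCoupling μ₀ μ₁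
      ((μ₀.prod μ₁).withDensity fun p => ENNReal.ofReal (gibbs ε φ ψ p.1 p.2)) := by
  have hm := (measurable_gibbs (ε := ε) hφ hψ).ennreal_ofReal
  constructor
  · ext A hA
    rw [Measure.map_apply measurable_fst hA, withDensity_apply _ (measurable_fst hA),
      ← prod_univ, ← Measure.prod_restrict, Measure.restrict_univ, lintegral_prod _ hm.aemeasurable]
    have : ∀ᵐ x ∂(μ₀.restrict A), ∫⁻ y, ENNReal.ofReal (gibbs ε φ ψ x y) ∂μ₁ = 1 := by
      refine ae_restrict_of_ae ?_
      filter_upwards [Measure.support_mem_ae (μ := μ₀)] with x hx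
      exact lintegral_ofReal_eq_one (fun y => (Real.exp_pos _).le) (hl x hx)
    rw [lintegral_congr_ae this]
    simp
  · ext A hA
    rw [Measure.map_apply measurable_snd hA, withDensity_apply _ (measurable_snd hA),
      ← univ_prod, ← Measure.prod_restrict, Measure.restrict_univ,
      lintegral_prod_symm _ hm.aemeasurable]
    have : ∀ᵐ y ∂(μ₁.restrict A), ∫⁻ x, ENNReal.ofReal (gibbs ε φ ψ x y) ∂μ₀ = 1 := by
      refine ae_restrict_of_ae ?_
      filter_upwards [Measure.support_mem_ae (μ := μ₁)] with y hy
      exact lintegral_ofReal_eq_one (fun x => (Real.exp_pos _).le) (hr y hy)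
    rw [lintegral_congr_ae this]
    simp

theorem IsCoupling.integral_exponent (hX : IsCompact μ₀.support) (hY : IsCompact μ₁.support)
    (hφ : Integrable φ μ₀) (hψ : Integrable ψ μ₁) {π : Measure (E d × E d)}
    (h : IsCoupling μ₀ μ₁ π) :
    Integrable (fun p : E d × E d => (φ p.1 + ψ p.2 - cost p.1 p.2) / ε) π ∧
    ∫ p, (φ p.1 + ψ p.2 - cost p.1 p.2) / ε ∂π =
      (∫ x, φ x ∂μ₀ + ∫ y, ψ y ∂μ₁ - ∫ p, cost p.1 p.2 ∂π) / ε := by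
  have hc := h.integrable_cost hX hY
  have h1 : Integrable (fun p : E d × E d => φ p.1) π :=
    Integrable.comp_measurable (by rwa [h.1]) measurable_fst
  have h2 : Integrable (fun p : E d × E d => ψ p.2) π :=
    Integrable.comp_measurable (by rwa [h.2]) measurable_snd
  refine ⟨((h1.add h2).sub hc).div_const ε, ?_⟩
  have e1 : ∫ x, φ x ∂μ₀ = ∫ p, φ p.1 ∂π := by
    have := hφ.aestronglyMeasurable
    rw [← h.1] at this ⊢
    exact integral_map measurable_fst.aemeasurable this
  have e2 : ∫ y, ψ y ∂μ₁ = ∫ p, ψ p.2 ∂π := by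
    have := hψ.aestronglyMeasurable
    rw [← h.2] at this ⊢
    exact integral_map measurable_snd.aemeasurable this
  rw [integral_div, integral_sub (f := fun p : E d × E d => φ p.1 + ψ p.2) (h1.add h2) hc,
    integral_add h1 h2, e1, e2]

theorem entropicCost_eq (hε : 0 < ε) (hX : IsCompact μ₀.support) (hY : IsCompact μ₁.support)
    {π : Measure (E d × E d)} (h : IsCoupling μ₀ μ₁ π) (hac : π ≪ μ₀.prod μ₁)
    (hi : Integrable (llr π (μ₀.prod μ₁)) π) :
    entropicCost ε μ₀ μ₁ π = ENNReal.ofReal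
      (∫ p, cost p.1 p.2 ∂π + ε * ∫ p, llr π (μ₀.prod μ₁) p ∂π) := by
  have := h.isProbabilityMeasure
  -- Nonnegativity of the relative entropy is needed because `ENNReal.ofReal` is additive only on
  -- nonnegative reals.
  have h0 := InformationTheory.integral_llr_add_sub_measure_univ_nonneg hac hi
  simp only [probReal_univ, add_sub_cancel_right] at h0
  rw [entropicCost, InformationTheory.klDiv_of_ac_of_integrable hac hi,
    ← ofReal_integral_eq_lintegral_ofReal (h.integrable_cost hX hY)
      (Eventually.of_forall fun p => cost_nonneg _ _)]
  simp only [probReal_univ, add_sub_cancel_right]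
  rw [← ENNReal.ofReal_mul hε.le, ← ENNReal.ofReal_add
    (integral_nonneg fun p => cost_nonneg _ _) (mul_nonneg hε.le h0)]

/-- A Gibbs density solving the Schrödinger system defines the entropic plan. -/
theorem isEOTPlan_gibbs (hε : 0 < ε) (hX : IsCompact μ₀.support) (hY : IsCompact μ₁.support)
    (hφm : Measurable φ) (hψm : Measurable ψ) (hφ : Integrable φ μ₀) (hψ : Integrable ψ μ₁)
    (hl : ∀ x ∈ μ₀.support, ∫ y, gibbs ε φ ψ x y ∂μ₁ = 1)
    (hr : ∀ y ∈ μ₁.support, ∫ x, gibbs ε φ ψ x y ∂μ₀ = 1) :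
    IsEOTPlan ε μ₀ μ₁
      ((μ₀.prod μ₁).withDensity fun p => ENNReal.ofReal (gibbs ε φ ψ p.1 p.2)) := by
  set P := μ₀.prod μ₁ with hP
  set a : E d × E d → ℝ := fun p => (φ p.1 + ψ p.2 - cost p.1 p.2) / ε with ha
  have hπ := isCoupling_gibbs hφm hψm hl hr
  rw [← hP] at hπ
  have hprob := hπ.isProbabilityMeasure
  have hl1 : ∫⁻ p, ENNReal.ofReal (Real.exp (a p)) ∂P = 1 := by
    have := hprob.measure_univ
    rwa [withDensity_apply _ MeasurableSet.univ, Measure.restrict_univ] at this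
  have hexpm : Measurable fun p => Real.exp (a p) := measurable_gibbs hφm hψm
  have hexp : Integrable (fun p => Real.exp (a p)) P := by
    refine ⟨hexpm.aestronglyMeasurable, ?_⟩
    rw [hasFiniteIntegral_iff_ofReal (Eventually.of_forall fun p => (Real.exp_pos _).le), hl1]
    exact ENNReal.one_lt_top
  have hexp1 : ∫ p, Real.exp (a p) ∂P = 1 := by
    rw [integral_eq_lintegral_of_nonneg_ae (Eventually.of_forall fun p => (Real.exp_pos _).le)
      hexpm.aestronglyMeasurable, hl1, ENNReal.toReal_one]
  -- Since the total mass is one, the Gibbs plan is the exponential tilt of `P` by `a`, and its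
  -- log-density is `a` itself.
  have htilt : P.withDensity (fun p => ENNReal.ofReal (gibbs ε φ ψ p.1 p.2)) = P.tilted a := by
    rw [Measure.tilted, hexp1]
    simp only [div_one]
    rfl
  rw [htilt] at hπ hprob ⊢
  refine ⟨hπ, fun ρ hρ => ?_⟩
  obtain ⟨i1, i2⟩ := hπ.integral_exponent (ε := ε) hX hY hφ hψ
  obtain ⟨j1, j2⟩ := hρ.integral_exponent (ε := ε) hX hY hφ hψ
  have hac : P.tilted a ≪ P := tilted_absolutelyContinuous P a
  have hllr : llr (P.tilted a) P =ᵐ[P.tilted a] a := by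
    have := log_rnDeriv_tilted_left_self hexp
    rw [hexp1] at this
    simp only [Real.log_one, sub_zero] at this
    exact hac.ae_le this
  have hcost : entropicCost ε μ₀ μ₁ (P.tilted a) =
      ENNReal.ofReal (∫ x, φ x ∂μ₀ + ∫ y, ψ y ∂μ₁) := by
    rw [entropicCost_eq hε hX hY hπ hac ((integrable_congr hllr).2 i1), integral_congr_ae hllr]
    simp only [ha]
    rw [i2]
    congr 1
    field_simp
    ring
  rw [hcost]
  by_cases hfin : ρ ≪ P ∧ Integrable (llr ρ P) ρ
  · obtain ⟨k1, k2⟩ := hfin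
    have := hρ.isProbabilityMeasure
    rw [entropicCost_eq hε hX hY hρ k1 k2]
    refine ENNReal.ofReal_le_ofReal ?_
    -- Changing the reference measure from `P` to the tilt shows that the objective at `ρ` equals `∫
    -- φ + ∫ ψ` plus `ε` times the entropy of `ρ` relative to the Gibbs plan, which is nonnegative.
    have h1 := integral_llr_tilted_right k1 j1 hexp k2
    have h2 := InformationTheory.integral_llr_add_sub_measure_univ_nonneg
      (k1.trans (absolutelyContinuous_tilted hexp)) (integrable_llr_tilted_right k1 j1 k2 hexp)
    simp only [probReal_univ, add_sub_cancel_right] at h2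
    rw [h1, hexp1, Real.log_one, add_zero, j2] at h2
    have h3 := mul_nonneg hε.le h2
    rw [mul_sub, mul_div_cancel₀ _ hε.ne'] at h3
    linarith
  · have : InformationTheory.klDiv ρ P = ⊤ :=
      InformationTheory.klDiv_eq_top_iff.2 fun h1 h2 => hfin ⟨h1, h2⟩
    rw [entropicCost, ← hP, this, ENNReal.mul_top (ENNReal.ofReal_pos.2 hε).ne', add_top]
    exact le_top

end Plan

/-! ### Passing to the supports as compact spaces of full measure. -/

section Support

variable {d : ℕ}

/-- The restriction of a measure to its support, as a measure on the subtype. -/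
noncomputable def suppMeasure (μ : Measure (E d)) : Measure μ.support :=
  μ.comap Subtype.val

theorem measurableEmbedding_support (μ : Measure (E d)) :
    MeasurableEmbedding (Subtype.val : μ.support → E d) :=
  MeasurableEmbedding.subtype_coe Measure.isClosed_support.measurableSet

theorem map_suppMeasure (μ : Measure (E d)) : (suppMeasure μ).map Subtype.val = μ := by
  rw [suppMeasure, (measurableEmbedding_support μ).map_comap, Subtype.range_coe]
  exact Measure.restrict_eq_self_of_ae_mem Measure.support_mem_ae

instance (μ : Measure (E d)) [IsProbabilityMeasure μ] : IsProbabilityMeasure (suppMeasure μ) := by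
  have : IsProbabilityMeasure ((suppMeasure μ).map Subtype.val) := by
    rw [map_suppMeasure]; infer_instance
  exact (Measure.isProbabilityMeasure_map_iff measurable_subtype_coe.aemeasurable).1 this

instance (μ : Measure (E d)) : (suppMeasure μ).IsOpenPosMeasure := by
  refine ⟨fun U hU ⟨x, hx⟩ h0 => ?_⟩
  obtain ⟨V, hV, rfl⟩ := isOpen_induced_iff.1 hU
  rw [← Measure.map_apply measurable_subtype_coe hV.measurableSet, map_suppMeasure] at h0
  exact ((Measure.mem_support_iff_forall (x : E d)).1 x.2 V (hV.mem_nhds hx)).ne' h0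

theorem integral_suppMeasure (μ : Measure (E d)) (f : E d → ℝ) :
    ∫ x : μ.support, f x ∂(suppMeasure μ) = ∫ x, f x ∂μ := by
  conv_rhs => rw [← map_suppMeasure μ]
  exact ((measurableEmbedding_support μ).integral_map f).symm

theorem integrable_suppMeasure {μ : Measure (E d)} {f : E d → ℝ} :
    Integrable (fun x : μ.support => f x) (suppMeasure μ) ↔ Integrable f μ := by
  conv_rhs => rw [← map_suppMeasure μ]
  exact (measurableEmbedding_support μ).integrable_map_iff.symm

theorem ae_suppMeasure {μ : Measure (E d)} {p : E d → Prop} :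
    (∀ᵐ x : μ.support ∂(suppMeasure μ), p x) ↔ ∀ᵐ x ∂μ, p x := by
  conv_rhs => rw [← map_suppMeasure μ]
  exact (measurableEmbedding_support μ).ae_map_iff.symm

theorem memL1_and_integralE_of_eq {μ : Measure (E d)} {f : E d → EReal} {g : μ.support → ℝ}
    (hg : Integrable g (suppMeasure μ)) (h : ∀ x : μ.support, f x = (g x : EReal)) :
    MemL1 f μ ∧ integralE f μ = ∫ x, g x ∂(suppMeasure μ) := by
  have e : (fun x : μ.support => (f x).toReal) = g := funext fun x => by rw [h, EReal.toReal_coe]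
  refine ⟨⟨?_, ?_⟩, ?_⟩
  · rw [← ae_suppMeasure]
    exact Eventually.of_forall fun x => by
      rw [h]; exact ⟨EReal.coe_ne_bot _, EReal.coe_ne_top _⟩
  · rw [← integrable_suppMeasure, e]
    exact hg
  · rw [integralE, ← integral_suppMeasure, e]

/-- Extension of a real function on a set by zero, with extended-real values. -/
noncomputable def erealExtend {S : Set (E d)} (g : S → ℝ) : E d → EReal :=
  fun x => ((Function.extend Subtype.val g 0 x : ℝ) : EReal)

theorem erealExtend_coe {S : Set (E d)} (g : S → ℝ) (x : S) :
    erealExtend g x = (g x : EReal) := by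
  rw [erealExtend, Subtype.val_injective.extend_apply]

end Support

/-! ### Regularity of the cost and of extended-real `c`-transforms. -/

section Cost

variable {d : ℕ}

theorem exists_lipschitzCost {S T : Set (E d)} (hS : IsCompact S) (hT : IsCompact T) :
    ∃ L : ℝ≥0, LipschitzCost L fun (x : S) (y : T) => cost (x : E d) y := by
  obtain ⟨R, hR⟩ := (hS.prod hT).exists_bound_of_continuousOn
    (f := fun p : E d × E d => p.1 - p.2) (by fun_prop)
  have hR' : ∀ x : S, ∀ y : T, ‖(x : E d) - y‖ ≤ R.toNNReal := fun x y =>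
    (hR ((x : E d), (y : E d)) ⟨x.2, y.2⟩).trans (Real.le_coe_toNNReal R)
  have key : ∀ u v : E d, ‖u‖ ≤ R.toNNReal → ‖v‖ ≤ R.toNNReal →
      ‖u‖ ^ 2 / 2 ≤ ‖v‖ ^ 2 / 2 + R.toNNReal * ‖u - v‖ := fun u v hu hv => by
    have h1 := norm_sub_norm_le u v
    nlinarith [norm_nonneg u, norm_nonneg v, norm_nonneg (u - v)]
  refine ⟨R.toNNReal, fun y => LipschitzWith.of_le_add_mul _ fun x x' => ?_,
    fun x => LipschitzWith.of_le_add_mul _ fun y y' => ?_⟩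
  · have := key _ _ (hR' x y) (hR' x' y)
    rwa [sub_sub_sub_cancel_right, ← dist_eq_norm] at this
  · have := key _ _ (hR' x y) (hR' x y')
    rwa [sub_sub_sub_cancel_left, ← dist_eq_norm (y' : E d) y, dist_comm (y' : E d) y] at this

theorem isRigid_cost_flip {S T : Set (E d)} (hT : IsClosureOfConnectedOpen T) :
    IsRigid fun (y : T) (x : S) => cost (x : E d) y := by
  have := isRigid_cost hT S
  simp_rw [cost_comm (_ : E d)] at this ⊢
  convert this using 3

theorem cTransform_eq_of_tight {S T : Set (E d)} {ψ : E d → EReal} {f : S → ℝ} {g : T → ℝ}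
    (hψ : ∀ y : T, ψ y = (g y : EReal)) (hle : ∀ x y, f x + g y ≤ cost (x : E d) y)
    (htight : ∀ x, ∃ y, f x + g y = cost (x : E d) y) (x : S) :
    cTransform T ψ x = (f x : EReal) := by
  refine le_antisymm ?_ (le_iInf₂ fun y hy => ?_)
  · obtain ⟨y, hy⟩ := htight x
    refine (iInf₂_le (y : E d) y.2).trans ?_
    rw [hψ, ← EReal.coe_sub, ← hy, add_sub_cancel_right]
  · rw [hψ ⟨y, hy⟩, ← EReal.coe_sub, EReal.coe_le_coe_iff]
    linarith [hle x ⟨y, hy⟩]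

theorem cTransform_sub_le {T : Set (E d)} (ψ : E d → EReal) {x x' : E d} {r : ℝ}
    (h : ∀ y ∈ T, cost x y ≤ cost x' y + r) :
    cTransform T ψ x - (r : EReal) ≤ cTransform T ψ x' := by
  refine le_iInf₂ fun y hy => ?_
  refine (EReal.sub_le_sub (iInf₂_le y hy) le_rfl).trans ?_
  induction ψ y using EReal.rec with
  | bot => simp
  | top => simp
  | coe b =>
    rw [← EReal.coe_sub, ← EReal.coe_sub, ← EReal.coe_sub, EReal.coe_le_coe_iff]
    linarith [h y hy]

/-- A `c`-transform in `L¹` is a real Lipschitz function on the support. -/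
theorem exists_lipschitz_of_memL1 {μ : Measure (E d)} [IsProbabilityMeasure μ] {T : Set (E d)}
    {L : ℝ≥0} (hL : ∀ y : T, LipschitzWith L fun x : μ.support => cost (x : E d) y)
    {f ψ : E d → EReal} (hf : MemL1 f μ) (h : EqOn f (cTransform T ψ) μ.support) :
    ∃ g : μ.support → ℝ, LipschitzWith L g ∧ ∀ x : μ.support, f x = (g x : EReal) := by
  have hsub : ∀ x x' : μ.support, f x - ((L * dist x x' : ℝ) : EReal) ≤ f x' := fun x x' => by
    rw [h x.2, h x'.2]
    refine cTransform_sub_le ψ fun y hy => ?_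
    have := (le_abs_self _).trans ((hL ⟨y, hy⟩).dist_le_mul x x')
    linarith
  -- Integrability provides one support point where `f` is finite; the Lipschitz inequality, valid
  -- in `EReal`, propagates finiteness to the whole support.
  obtain ⟨x₀, ⟨hb, ht⟩, hx₀⟩ := (hf.1.and Measure.support_mem_ae).exists
  have hfin : ∀ x : μ.support, f x ≠ ⊥ ∧ f x ≠ ⊤ := fun x => by
    constructor
    · intro hx
      have := hsub ⟨x₀, hx₀⟩ x
      rw [hx, le_bot_iff] at this
      lift f x₀ to ℝ using ⟨ht, hb⟩ with b
      rw [← EReal.coe_sub] at this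
      exact EReal.coe_ne_bot _ this
    · intro hx
      have := hsub x ⟨x₀, hx₀⟩
      rw [hx, EReal.top_sub_coe, top_le_iff] at this
      exact ht this
  have hg : ∀ x : μ.support, f x = ((f x).toReal : EReal) := fun x =>
    (EReal.coe_toReal (hfin x).2 (hfin x).1).symm
  refine ⟨fun x => (f x).toReal, LipschitzWith.of_le_add_mul L fun x x' => ?_, hg⟩
  have := hsub x x'
  rw [hg x, hg x', ← EReal.coe_sub, EReal.coe_le_coe_iff] at this
  linarith

theorem boundedLipschitzOn_of_eq {S : Set (E d)} (hS : IsCompact S) {f : E d → EReal} {L : ℝ≥0}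
    {g : S → ℝ} (hg : LipschitzWith L g) (h : ∀ x : S, f x = (g x : EReal)) :
    BoundedLipschitzOn f S := by
  have := isCompact_iff_compactSpace.1 hS
  obtain ⟨M, hM⟩ := isCompact_univ.exists_bound_of_continuousOn hg.continuous.continuousOn
  refine ⟨⟨M, fun x hx => ?_⟩, L, ?_⟩
  · rw [h ⟨x, hx⟩, EReal.coe_le_coe_iff, EReal.coe_le_coe_iff]
    exact abs_le.1 (hM ⟨x, hx⟩ trivial)
  · rw [lipschitzOnWith_iff_restrict]
    convert hg using 1
    ext x
    simp [h x]

end Cost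

/-! ### Correspondence between potentials on the whole space and on the supports. -/

section Potentials

set_option linter.unusedSectionVars false

variable {d : ℕ} {μ₀ μ₁ : Measure (E d)} [IsProbabilityMeasure μ₀] [IsProbabilityMeasure μ₁]
  {L : ℝ≥0}

/-- Both `ψ` and its transform are `c`-transforms in `L¹`, hence real and Lipschitz on the supports.
Uniqueness of dual optimal pairs therefore applies to any potential. -/
theorem IsOTPotential.exists_dualOptimal (hX : IsCompact μ₀.support) (hY : IsCompact μ₁.support)
    (hc : LipschitzCost L fun (x : μ₀.support) (y : μ₁.support) => cost (x : E d) y)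
    {ψ : E d → EReal} (h : IsOTPotential μ₀ μ₁ ψ) :
    ∃ (f : μ₀.support → ℝ) (g : μ₁.support → ℝ),
      (∀ x : μ₀.support, cTransform μ₁.support ψ x = (f x : EReal)) ∧
      (∀ y : μ₁.support, ψ y = (g y : EReal)) ∧
      IsDualOptimal (fun (x : μ₀.support) (y : μ₁.support) => cost (x : E d) y)
        (suppMeasure μ₀) (suppMeasure μ₁) f g := by
  have := isCompact_iff_compactSpace.1 hX
  have := isCompact_iff_compactSpace.1 hY
  have : Nonempty μ₁.support := nonempty_of_isProbabilityMeasure (suppMeasure μ₁)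
  obtain ⟨χ, -, -, hχ⟩ := h.cConcave
  obtain ⟨f, hf, hf'⟩ := exists_lipschitz_of_memL1 hc.left h.memL1_cTransform (eqOn_refl _ _)
  obtain ⟨g, hg, hg'⟩ := exists_lipschitz_of_memL1 (T := μ₀.support)
    (fun x => by simp_rw [cost_comm _ (x : E d)]; exact hc.right x) h.memL1 hχ
  refine ⟨f, g, hf', hg', hf.continuous, hg.continuous, fun x y => ?_, fun f' g' h1 h2 h3 => ?_⟩
  · have : cTransform μ₁.support ψ x ≤ _ := iInf₂_le (y : E d) y.2
    rw [hf', hg', ← EReal.coe_sub, EReal.coe_le_coe_iff] at this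
    linarith
  -- Maximality of `ψ` concerns pairs of the form `(ψ'ᶜ, ψ')`, so a general feasible `f'` is first
  -- raised to the conjugate of `g'`.
  · obtain ⟨f'', h4, h5, h6⟩ := exists_conjugate hc h2
    obtain ⟨k1, k2⟩ := memL1_and_integralE_of_eq (μ := μ₁) (continuous_integrable h2)
      (erealExtend_coe g')
    obtain ⟨k3, k4⟩ := memL1_and_integralE_of_eq (μ := μ₀) (continuous_integrable h4.continuous)
      (cTransform_eq_of_tight (erealExtend_coe g') h5 h6)
    have h7 := h.maximal _ k1 k3
    rw [k2, k4, (memL1_and_integralE_of_eq (continuous_integrable hf.continuous) hf').2,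
      (memL1_and_integralE_of_eq (continuous_integrable hg.continuous) hg').2] at h7
    have h8 : ∫ x, f' x ∂(suppMeasure μ₀) ≤ ∫ x, f'' x ∂(suppMeasure μ₀) :=
      integral_mono (continuous_integrable h1) (continuous_integrable h4.continuous) fun x => by
        obtain ⟨y, hy⟩ := h6 x
        linarith [h3 x y]
    linarith

theorem isOTPotential_of_dualOptimal (hX : IsCompact μ₀.support) (hY : IsCompact μ₁.support)
    (hc : LipschitzCost L fun (x : μ₀.support) (y : μ₁.support) => cost (x : E d) y)
    {f : μ₀.support → ℝ} {g : μ₁.support → ℝ}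
    (h : IsDualOptimal (fun (x : μ₀.support) (y : μ₁.support) => cost (x : E d) y)
        (suppMeasure μ₀) (suppMeasure μ₁) f g)
    (hmax : ∀ (f' : μ₀.support → ℝ) (g' : μ₁.support → ℝ), Integrable f' (suppMeasure μ₀) →
      Integrable g' (suppMeasure μ₁) →
      (∀ᵐ p ∂((suppMeasure μ₀).prod (suppMeasure μ₁)),
        f' p.1 + g' p.2 ≤ cost (p.1 : E d) p.2) →
      ∫ x, f' x ∂(suppMeasure μ₀) + ∫ y, g' y ∂(suppMeasure μ₁) ≤
        ∫ x, f x ∂(suppMeasure μ₀) + ∫ y, g y ∂(suppMeasure μ₁)) :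
    (∀ x : μ₀.support, cTransform μ₁.support (erealExtend g) x = (f x : EReal)) ∧
    IsOTPotential μ₀ μ₁ (erealExtend g) := by
  have := isCompact_iff_compactSpace.1 hX
  have := isCompact_iff_compactSpace.1 hY
  obtain ⟨x₀⟩ : Nonempty μ₀.support := nonempty_of_isProbabilityMeasure (suppMeasure μ₀)
  have ht := cTransform_eq_of_tight (erealExtend_coe g) h.feasible (h.exists_tight hc)
  have ht' := cTransform_eq_of_tight (erealExtend_coe f) (f := g)
    (fun y x => by rw [cost_comm]; exact h.swap.feasible y x)
    (fun y => by
      obtain ⟨x, hx⟩ := h.swap.exists_tight hc.flip y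
      exact ⟨x, by rw [cost_comm]; exact hx⟩)
  obtain ⟨k1, k2⟩ := memL1_and_integralE_of_eq (continuous_integrable h.continuous_right)
    (erealExtend_coe g)
  obtain ⟨k3, k4⟩ := memL1_and_integralE_of_eq (continuous_integrable h.continuous_left) ht
  refine ⟨ht, ⟨erealExtend f, fun x _ => EReal.coe_ne_top _, ⟨x₀, x₀.2, EReal.coe_ne_bot _⟩,
    fun y hy => ?_⟩, k1, k3, fun ψ' h1 h2 => ?_⟩
  · rw [erealExtend_coe g ⟨y, hy⟩, ht' ⟨y, hy⟩]
  · rw [k2, k4, integralE, integralE, ← integral_suppMeasure, ← integral_suppMeasure]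
    refine hmax _ _ (integrable_suppMeasure.2 h2.2) (integrable_suppMeasure.2 h1.2) ?_
    -- A competitor in `L¹` is finite only almost everywhere, so its real parts are feasible only
    -- almost everywhere; `hmax` is stated in that generality.
    filter_upwards [Measure.quasiMeasurePreserving_fst.ae (ae_suppMeasure.2 h2.1),
      Measure.quasiMeasurePreserving_snd.ae (ae_suppMeasure.2 h1.1)] with p hp1 hp2
    have : cTransform μ₁.support ψ' p.1 ≤ _ := iInf₂_le (p.2 : E d) p.2.2
    rw [← EReal.coe_toReal hp1.2 hp1.1, ← EReal.coe_toReal hp2.2 hp2.1, ← EReal.coe_sub,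
      EReal.coe_le_coe_iff] at this
    linarith

theorem IsNormalizedEOTPotentials.schrodingerSystem {ε : ℝ} {φ ψ : E d → ℝ}
    (h : IsNormalizedEOTPotentials ε μ₀ μ₁ φ ψ) :
    SchrodingerSystem ε (fun (x : μ₀.support) (y : μ₁.support) => cost (x : E d) y)
      (suppMeasure μ₀) (suppMeasure μ₁) (fun x => φ x) (fun y => ψ y) ∧
    ∫ x : μ₀.support, φ x ∂(suppMeasure μ₀) = ∫ y : μ₁.support, ψ y ∂(suppMeasure μ₁) := by
  refine ⟨⟨fun x => ?_, fun y => ?_⟩, ?_⟩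
  · rw [← h.system_left x x.2]
    exact integral_suppMeasure μ₁ fun y => gibbs ε φ ψ x y
  · rw [← h.system_right y y.2]
    simp_rw [add_comm (ψ y)]
    exact integral_suppMeasure μ₀ fun x => gibbs ε φ ψ x y
  · rw [integral_suppMeasure, integral_suppMeasure, h.normalized]

theorem exists_normalizedEOTPotentials {ε : ℝ} (hε : 0 < ε) (hX : IsCompact μ₀.support)
    (hY : IsCompact μ₁.support)
    (hc : LipschitzCost L fun (x : μ₀.support) (y : μ₁.support) => cost (x : E d) y) :
    ∃ φ ψ : E d → ℝ, IsNormalizedEOTPotentials ε μ₀ μ₁ φ ψ := by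
  have := isCompact_iff_compactSpace.1 hX
  have := isCompact_iff_compactSpace.1 hY
  obtain ⟨f, g, h, hn⟩ :=
    exists_normalized_schrodingerSystem hε hc (suppMeasure μ₀) (suppMeasure μ₁)
  have hf := (h.left.lipschitzWith hε hc.left).continuous
  have hg := (h.right.lipschitzWith hε hc.right).continuous
  -- Values off the supports do not affect the system, but the zero extension keeps the potentials
  -- measurable, as the Gibbs plan requires.
  set φ : E d → ℝ := Function.extend Subtype.val f 0
  set ψ : E d → ℝ := Function.extend Subtype.val g 0
  have hφ : ∀ x : μ₀.support, φ x = f x := Subtype.val_injective.extend_apply f 0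
  have hψ : ∀ y : μ₁.support, ψ y = g y := Subtype.val_injective.extend_apply g 0
  have hφm : Measurable φ :=
    (measurableEmbedding_support μ₀).measurable_extend hf.measurable measurable_zero
  have hψm : Measurable ψ :=
    (measurableEmbedding_support μ₁).measurable_extend hg.measurable measurable_zero
  have hφi : Integrable φ μ₀ := by
    rw [← integrable_suppMeasure]; simp_rw [hφ]; exact continuous_integrable hf
  have hψi : Integrable ψ μ₁ := by
    rw [← integrable_suppMeasure]; simp_rw [hψ]; exact continuous_integrable hg
  have hl : ∀ x ∈ μ₀.support, ∫ y, gibbs ε φ ψ x y ∂μ₁ = 1 := fun x hx => by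
    rw [← integral_suppMeasure, ← h.left ⟨x, hx⟩]
    simp only [gibbs, hψ, hφ ⟨x, hx⟩]
  have hr : ∀ y ∈ μ₁.support, ∫ x, gibbs ε φ ψ x y ∂μ₀ = 1 := fun y hy => by
    rw [← integral_suppMeasure, ← h.right ⟨y, hy⟩]
    simp only [gibbs, hφ, hψ ⟨y, hy⟩, add_comm (g _)]
  refine ⟨φ, ψ, ⟨hφi, hψi, isEOTPlan_gibbs hε hX hY hφm hψm hφi hψi hl hr, hl, hr⟩, ?_⟩
  rw [← integral_suppMeasure, ← integral_suppMeasure μ₁]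
  simp_rw [hφ, hψ]
  exact hn

end Potentials

end EOTLemma

/-! ### The main theorem. -/

theorem mainTheorem8 {d : ℕ} (μ₀ μ₁ : MeasureTheory.Measure (EOTLemma.E d))
    [MeasureTheory.IsProbabilityMeasure μ₀] [MeasureTheory.IsProbabilityMeasure μ₁]
    (hX : IsCompact μ₀.support) (hY : IsCompact μ₁.support)
    (hconn : EOTLemma.IsClosureOfConnectedOpen μ₀.support ∨
      EOTLemma.IsClosureOfConnectedOpen μ₁.support) :
    -- the normalized potential exists, is unique everywhere on the support, and is regular
    ∃ ψ : EOTLemma.E d → EReal,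
      EOTLemma.IsNormalizedOTPotential μ₀ μ₁ ψ ∧
      (∀ ψ' : EOTLemma.E d → EReal, EOTLemma.IsNormalizedOTPotential μ₀ μ₁ ψ' →
        Set.EqOn ψ' ψ μ₁.support) ∧
      EOTLemma.BoundedLipschitzOn (EOTLemma.cTransform μ₁.support ψ) μ₀.support ∧
      EOTLemma.BoundedLipschitzOn ψ μ₁.support ∧
      -- for every `ε > 0` the normalized entropic potentials exist and are unique
      (∀ ε : ℝ, 0 < ε → ∃ φε ψε : EOTLemma.E d → ℝ,
        EOTLemma.IsNormalizedEOTPotentials ε μ₀ μ₁ φε ψε ∧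
        ∀ φ' ψ' : EOTLemma.E d → ℝ, EOTLemma.IsNormalizedEOTPotentials ε μ₀ μ₁ φ' ψ' →
          Set.EqOn φ' φε μ₀.support ∧ Set.EqOn ψ' ψε μ₁.support) ∧
      -- they converge uniformly to the pair of optimal transport potentials
      (∀ (ε : ℕ → ℝ) (φ ψ' : ℕ → EOTLemma.E d → ℝ),
        (∀ k, 0 < ε k) → Filter.Tendsto ε Filter.atTop (nhds 0) →
        (∀ k, EOTLemma.IsNormalizedEOTPotentials (ε k) μ₀ μ₁ (φ k) (ψ' k)) →
        TendstoUniformlyOn φ (fun x => (EOTLemma.cTransform μ₁.support ψ x).toReal)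
          Filter.atTop μ₀.support ∧
        TendstoUniformlyOn ψ' (fun y => (ψ y).toReal) Filter.atTop μ₁.support) := by
  have := isCompact_iff_compactSpace.1 hX
  have := isCompact_iff_compactSpace.1 hY
  obtain ⟨L, hc⟩ := EOTLemma.exists_lipschitzCost hX hY
  obtain ⟨C, hC⟩ := EOTLemma.exists_cost_le hX hY
  have hr := hconn.imp (fun h => EOTLemma.isRigid_cost h μ₁.support)
    (fun h => EOTLemma.isRigid_cost_flip (S := μ₀.support) h)
  have hC' : ∀ (x : μ₀.support) (y : μ₁.support), EOTLemma.cost (x : EOTLemma.E d) y ≤ C :=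
    fun x y => hC x x.2 y y.2
  obtain ⟨f, g, hf, hg, hn, hopt, hmax⟩ := EOTLemma.exists_dualOptimal
    (ν := EOTLemma.suppMeasure μ₁) hc (fun x y => EOTLemma.cost_nonneg _ _) hC'
    (EOTLemma.suppMeasure μ₀)
  obtain ⟨hT, hOT⟩ := EOTLemma.isOTPotential_of_dualOptimal hX hY hc hopt hmax
  have hG := EOTLemma.erealExtend_coe g
  refine ⟨EOTLemma.erealExtend g, ⟨hOT, ?_⟩, fun ψ' h' => ?_,
    EOTLemma.boundedLipschitzOn_of_eq hX hf hT, EOTLemma.boundedLipschitzOn_of_eq hY hg hG,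
    fun ε hε => ?_, fun ε φ ψ' hε hε0 h => ?_⟩
  · rw [(EOTLemma.memL1_and_integralE_of_eq
      (EOTLemma.continuous_integrable hf.continuous) hT).2,
      (EOTLemma.memL1_and_integralE_of_eq (EOTLemma.continuous_integrable hg.continuous) hG).2, hn]
  · obtain ⟨f', g', h1, h2, h3⟩ := h'.toIsOTPotential.exists_dualOptimal hX hY hc
    have hn' := h'.normalized
    rw [(EOTLemma.memL1_and_integralE_of_eq
      (EOTLemma.continuous_integrable h3.continuous_left) h1).2,
      (EOTLemma.memL1_and_integralE_of_eq
        (EOTLemma.continuous_integrable h3.continuous_right) h2).2] at hn'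
    have e := (h3.unique hc hr hopt hn' hn).2
    intro y hy
    rw [h2 ⟨y, hy⟩, hG ⟨y, hy⟩, e]
  · obtain ⟨φε, ψε, h⟩ := EOTLemma.exists_normalizedEOTPotentials hε hX hY hc
    refine ⟨φε, ψε, h, fun φ' ψ' h' => ?_⟩
    obtain ⟨h1, h2⟩ := h.schrodingerSystem
    obtain ⟨h3, h4⟩ := h'.schrodingerSystem
    obtain ⟨e1, e2⟩ := h3.unique hε hc h1 h4 h2
    exact ⟨fun x hx => congrFun e1 ⟨x, hx⟩, fun y hy => congrFun e2 ⟨y, hy⟩⟩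
  · obtain ⟨h1, h2⟩ := EOTLemma.tendstoUniformly_of_isRigid hc
      (fun x y => EOTLemma.cost_nonneg _ _) hC' hr hopt hn hε hε0
      (fun k => (h k).schrodingerSystem.1) (fun k => (h k).schrodingerSystem.2)
    rw [tendstoUniformlyOn_iff_tendstoUniformly_comp_coe,
      tendstoUniformlyOn_iff_tendstoUniformly_comp_coe]
    constructor
    · convert h1 using 1
      ext x
      simp [hT x]
    · convert h2 using 1
      ext y
      simp [hG y]
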